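/- **Setting.** Let $r,s$ be positive integers and $\nu_0=1/\sqrt{rs}$, $\nu=r\nu_0=\sqrt{r/s}$, so that $1/\nu=s\nu_0$. Let $\mathcal D_b$ be the space of finite complex linear combinations of the orthonormal boson states $\eta^b_{Q,\mathbf m}=\prod_{k\ge1}(k^{m_k}m_k!)^{-1/2}c_{-k}^{m_k}R^Q|0\rangle$ ($Q\in\mathbb Z$, $m_k\in\mathbb N_0$, finitely many non-zero), where $[c_n,c_m]=n\delta_{n+m,0}$, $[c_n,R]=\delta_{n,0}R$, $c_n^\dagger=c_{-n}$, $R^\dagger=R^{-1}$, $c_n|0\rangle=0$ for $n\ge0$, $\langle0|R^Q|0\rangle=\delta_{Q,0}$. Write $|Q\rangle=R^Q|0\rangle$, $\mathcal Q=\nu_0c_0$, and let $:\!\cdots\!:$ denote normal ordering. On $\mathcal D_b$ put $$\mathcal H^{\nu,1}=\tfrac1\nu\mathcal Q,\qquad \mathcal H^{\nu,2}=\tfrac12\mathcal Q^2+\sum_{n>0}c_{-n}c_n,$$ $$\mathcal H^{\nu,3}=\frac\nu3\sum_{n,m,\ell\ne0}:\!c_nc_mc_\ell\!:\delta_{n+m+\ell,0}+\sum_{n>0}\bigl[(1-\nu^2)n+2\nu\mathcal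 Q\bigr]c_{-n}c_n+\frac\nu3\mathcal Q^3-\frac{\nu^3}{12}\mathcal Q .$$ For $\mu\in\nu_0\mathbb Z$ and $\operatorname{Im}x<0$, let $$\phi_\mu(x)=\exp\Bigl(-\mu\sum_{n<0}\tfrac{c_n}{n}e^{inx}\Bigr)e^{-i\mu\mathcal Qx/2}R^{\mu/\nu_0}e^{-i\mu\mathcal Qx/2}\exp\Bigl(-\mu\sum_{n>0}\tfrac{c_n}{n}e^{inx}\Bigr)$$ as a quadratic form on $\mathcal D_b$, $\check\phi_\mu(x)=e^{i\mu\mathcal Qx/2}\phi_\mu(x)e^{i\mu\mathcal Qx/2}$, and let $\hat\phi_\mu(n)=\frac1{2\pi}\int_{-\pi-i\epsilon}^{\pi-i\epsilon}\check\phi_\mu(x)e^{inx}\,dx$ ($\epsilon>0$, $n\in\mathbb Z$), which is a well-defined operator $\mathcal D_b\to\mathcal D_b$ independent of $\epsilon$. Let $N,M\in\mathbb N_0$ and $Q\in\mathbb Z$. For $\mathbf m\in\mathbb Z^{N+M}$ let $$\eta(\mathbf m)=\hat\phi_\nu(m_1)\cdots\hat\phi_\nu(m_N)\hat\phi_{-1/\nu}(m_{N+1})\cdots\hat\phi_{-1/\nu}(m_{N+M})|Q\rangle\in\mathcal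 D_b,$$ $$m_j^+=\begin{cases}m_j+\nu^2(N+\tfrac12-j)-M+\nu\nu_0Q&(1\le j\le N)\\ m_j+\nu^{-2}(M+\tfrac12-(j-N))-\nu^{-1}\nu_0Q&(N<j\le N+M),\end{cases}$$ $$E_1=N-\nu^{-2}M+\nu^{-1}\nu_0Q,\qquad E_2(\mathbf m)=\sum_{j=1}^{N+M}m_j^++\tfrac12(\nu_0Q)^2,$$ $$E_3(\mathbf m)=\sum_{j=1}^N(m_j^+)^2-\nu^2\sum_{j=1}^M(m_{N+j}^+)^2+\tfrac1{12}(\nu^2-\nu^{-2})M+\tfrac{\nu(\nu_0Q)^3}3-\tfrac{\nu^3\nu_0Q}{12}.$$ Let $\nu_j=\nu$ for $j\le N$, $\nu_j=-1/\nu$ for $j>N$, and $\gamma_{jk}=\nu\nu_k(\nu_j^2-1)$. Write $\mathbf m\preceq\mathbf n$ if $m_j+\cdots+m_{N+M}\le n_j+\cdots+n_{N+M}$ for all $j$, and $\mathbf m\prec\mathbf n$ if moreover $\mathbf m\ne\mathbf n$. Fix $\mathbf n\in\mathbb N_0^{N+M}$, let $b_{\mathbf n}(\mathbf m)=E_3(\mathbf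 m)-E_3(\mathbf n)$, and let $A_{\mathbf n}$ be the set of all $\mathbf m=\mathbf n+\sum_{j<k}\mu_{jk}(\mathbf e_j-\mathbf e_k)$ with $\mu_{jk}\in\mathbb N_0$ and $m_j+\cdots+m_{N+M}\ge0$ for all $j$. The vector $\mathbf n$ satisfies the *non-degeneracy condition* if $b_{\mathbf n}(\mathbf m)\ne0$ for all $\mathbf m\in A_{\mathbf n}$ with $\mathbf m\ne\mathbf n$. **Proposition.** (a) If $M=0$, or $N=0$, or $N=M=1$, and if $$s-r\ge Q\ge1-r,\qquad n_1\ge\cdots\ge n_N\ge M+\chi_{Q>0},\qquad n_{N+1}\ge\cdots\ge n_{N+M}\ge0$$ (with $\chi_{Q>0}=1$ for $Q>0$ and $0$ otherwise), then $\mathbf n$ satisfies the non-degeneracy condition. (b) Assume that $\mathbf n$ satisfies the non-degeneracy condition. Then $A_{\mathbf n}$ is finite, and there is exactly one family of coefficients $u_{\mathbf n}(\mathbf m)\in\mathbb C$ ($\mathbf m\in\mathbb Z^{N+M}$) such that $u_{\mathbf n}(\mathbf m)=0$ for $\mathbf m\succ\mathbf n$, $u_{\mathbf n}(\mathbf n)=1$,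 $$u_{\mathbf n}(\mathbf m)=\frac2{b_{\mathbf n}(\mathbf m)}\sum_{j<k}\gamma_{jk}\sum_{\mu=1}^\infty\mu\,u_{\mathbf n}(\mathbf m-\mu[\mathbf e_j-\mathbf e_k])\qquad(\mathbf m\in A_{\mathbf n},\ \mathbf m\ne\mathbf n),$$ and $u_{\mathbf n}(\mathbf m)=0$ for all other $\mathbf m$. Only finitely many $u_{\mathbf n}(\mathbf m)$ are non-zero, so that $$\tilde\psi(\mathbf n)=\eta(\mathbf n)+\sum_{\mathbf m\prec\mathbf n}u_{\mathbf n}(\mathbf m)\eta(\mathbf m)$$ is a uniquely determined state in $\mathcal D_b$. If $\tilde\psi(\mathbf n)\ne0$, then it is a common eigenstate of $\mathcal H^{\nu,1}$, $\mathcal H^{\nu,2}$, $\mathcal H^{\nu,3}$ with eigenvalues $E_1$, $E_2(\mathbf n)$, $E_3(\mathbf n)$, respectively. -/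

import Mathlib

/-! The bosonic Fock space, its vertex operators, and the collective-field Hamiltonians.

The pre-Hilbert space of finite linear combinations of the orthonormal boson states
`η(Q, m) = ∏ₖ (k ^ mₖ mₖ!)^(-1/2) c₋ₖ ^ mₖ R ^ Q |0⟩` is realised on its orthonormal basis:
it is the space of finitely supported functions of the label `(Q, m)`. -/

namespace AnyonCFT

/-- Labels of the boson states: the charge `Q` and the occupation numbers `m₁, m₂, …`. -/
abbrev Label : Type := ℤ × (ℕ+ →₀ ℕ)

/-- Finite complex linear combinations of boson states. -/
abbrev Db : Type := Label →₀ ℂ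

/-- The boson state with a given label. -/
noncomputable def boson (a : Label) : Db := Finsupp.single a 1

/-- The inner product for which the boson states are orthonormal; it is linear in the second
argument. -/
noncomputable def ip (v w : Db) : ℂ := v.sum fun a z => (starRingEnd ℂ) z * w a

/-- The linear operator with prescribed values on the boson states. -/
noncomputable def ofBoson (f : Label → Db) : Module.End ℂ Db := Finsupp.linearCombination ℂ f

/-- The sum of a family of operators only finitely many of which are nonzero on any given boson
state. -/
noncomputable def locSum {ι : Type} (T : ι → Module.End ℂ Db) : Module.End ℂ Db :=
  ofBoson fun a => ∑ᶠ i, T i (boson a)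

/-- The exponential series of a locally nilpotent operator. -/
noncomputable def expOp (T : Module.End ℂ Db) : Module.End ℂ Db :=
  locSum fun p : ℕ => ((p.factorial : ℂ)⁻¹) • T ^ p

/-- The operator `cₖ` for `k > 0`, which lowers the occupation number `mₖ`. -/
noncomputable def lower (k : ℕ+) : Module.End ℂ Db :=
  ofBoson fun a => ((√((k : ℝ) * a.2 k) : ℝ) : ℂ) • boson (a.1, a.2 - Finsupp.single k 1)

/-- The operator `c₋ₖ` for `k > 0`, which raises the occupation number `mₖ`. -/
noncomputable def raise (k : ℕ+) : Module.End ℂ Db :=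
  ofBoson fun a => ((√((k : ℝ) * (a.2 k + 1)) : ℝ) : ℂ) • boson (a.1, a.2 + Finsupp.single k 1)

/-- The operators `cₙ`; `c₀` is the charge. -/
noncomputable def c : ℤ → Module.End ℂ Db
  | Int.ofNat 0 => ofBoson fun a => (a.1 : ℂ) • boson a
  | Int.ofNat (k + 1) => lower k.succPNat
  | Int.negSucc k => raise k.succPNat

/-- The power `R ^ q` of the charge raising operator. -/
noncomputable def Rpow (q : ℤ) : Module.End ℂ Db := ofBoson fun a => boson (a.1 + q, a.2)

/-- The state `|Q⟩ = R ^ Q |0⟩`. -/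
noncomputable def charged (Q : ℤ) : Db := Rpow Q (boson (0, 0))

/-- Normal ordering of a product of the operators `cₙ`. -/
noncomputable def normalOrder : List ℤ → Module.End ℂ Db
  | [] => 1
  | n :: l =>
      if 0 < n then normalOrder l * c n
      else if n < 0 then c n * normalOrder l
      else (1 / 2 : ℂ) • (normalOrder l * c 0 + c 0 * normalOrder l)

/-- The charge operator in units of the statistics parameter unit, `𝒬 = ν₀ c₀`. -/
noncomputable def chargeOp (ν₀ : ℝ) : Module.End ℂ Db := (ν₀ : ℂ) • c 0

/-- `H^{ν,1} = 𝒬 / ν`. -/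
noncomputable def H1 (ν₀ ν : ℝ) : Module.End ℂ Db := ((ν : ℂ)⁻¹) • chargeOp ν₀

/-- `H^{ν,2} = 𝒬² / 2 + ∑_{n > 0} c₋ₙ cₙ`. -/
noncomputable def H2 (ν₀ : ℝ) : Module.End ℂ Db :=
  (1 / 2 : ℂ) • chargeOp ν₀ ^ 2 + locSum fun n : ℕ+ => c (-(n : ℤ)) * c n

/-- `H^{ν,3} = (ν/3) ∑_{n,m,ℓ ≠ 0} :cₙ cₘ c_ℓ: δ_{n+m+ℓ,0}
      + ∑_{n > 0} [(1 - ν²) n + 2 ν 𝒬] c₋ₙ cₙ + (ν/3) 𝒬³ - (ν³/12) 𝒬`. -/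
noncomputable def H3 (ν₀ ν : ℝ) : Module.End ℂ Db :=
  ((ν : ℂ) / 3) • (locSum fun p : {p : ℤ × ℤ × ℤ //
      p.1 ≠ 0 ∧ p.2.1 ≠ 0 ∧ p.2.2 ≠ 0 ∧ p.1 + p.2.1 + p.2.2 = 0} =>
        normalOrder [p.1.1, p.1.2.1, p.1.2.2])
  + (locSum fun n : ℕ+ =>
      (((1 - (ν : ℂ) ^ 2) * (n : ℂ)) • (1 : Module.End ℂ Db) + (2 * (ν : ℂ)) • chargeOp ν₀)
        * (c (-(n : ℤ)) * c n))
  + ((ν : ℂ) / 3) • chargeOp ν₀ ^ 3 - ((ν : ℂ) ^ 3 / 12) • chargeOp ν₀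

/-- The operator `exp (z 𝒬)`. -/
noncomputable def expCharge (ν₀ : ℝ) (z : ℂ) : Module.End ℂ Db :=
  ofBoson fun a => Complex.exp (z * (ν₀ * a.1)) • boson a

/-- The annihilation field `∑_{n > 0} (cₙ / n) e^{i n x}`. -/
noncomputable def annField (x : ℂ) : Module.End ℂ Db :=
  locSum fun n : ℕ+ => (Complex.exp (Complex.I * n * x) / n) • c n

/-- The vertex operator with statistics parameter `ν = k ν₀`, as a quadratic form. Formally it is
`⟨v, φ(x) w⟩` with
`φ(x) = exp (-ν ∑_{n<0} (cₙ/n) e^{inx}) e^{-iν𝒬x/2} R ^ k e^{-iν𝒬x/2} exp (-ν ∑_{n>0} (cₙ/n) e^{inx})`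
where the first factor, which does not preserve the space of finite linear combinations, acts
through its adjoint `exp (ν ∑_{n>0} (cₙ/n) e^{in x̄})` on the left argument. -/
noncomputable def vertexForm (ν₀ : ℝ) (k : ℤ) (x : ℂ) (v w : Db) : ℂ :=
  let ν : ℂ := (k : ℂ) * ν₀
  ip (expOp (ν • annField ((starRingEnd ℂ) x)) v)
    (expCharge ν₀ (-(Complex.I * ν * x / 2)) (Rpow k (expCharge ν₀ (-(Complex.I * ν * x / 2))
      (expOp (-ν • annField x) w))))

/-- The `2π`-periodic modification `e^{iν𝒬x/2} φ(x) e^{iν𝒬x/2}` of the vertex operator with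
`ν = k ν₀`, as a quadratic form. The adjoint of `e^{iν𝒬x/2}` is `e^{-iν𝒬x̄/2}`. -/
noncomputable def periodicVertexForm (ν₀ : ℝ) (k : ℤ) (x : ℂ) (v w : Db) : ℂ :=
  let ν : ℂ := (k : ℂ) * ν₀
  vertexForm ν₀ k x (expCharge ν₀ (-(Complex.I * ν * (starRingEnd ℂ) x / 2)) v)
    (expCharge ν₀ (Complex.I * ν * x / 2) w)

/-- `T` is the `n`-th Fourier mode of the periodic vertex operator: its matrix elements between
boson states are the contour integrals
`(1/2π) ∫_{-π-iε}^{π-iε} ⟨a, φ̌(x) b⟩ e^{inx} dx`, for every `ε > 0`. -/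
def IsFourierMode (ν₀ : ℝ) (k n : ℤ) (T : Module.End ℂ Db) : Prop :=
  ∀ ε : ℝ, 0 < ε → ∀ a b : Label,
    T (boson b) a = (1 / (2 * (Real.pi : ℂ))) * ∫ t in (-Real.pi)..Real.pi,
      periodicVertexForm ν₀ k (t - ε * Complex.I) (boson a) (boson b) *
        Complex.exp (Complex.I * n * (t - ε * Complex.I))

/-! ### Existence of the Fourier modes -/

theorem ofBoson_boson (f : Label → Db) (a : Label) : ofBoson f (boson a) = f a := by
  simp [ofBoson, boson]

theorem end_ext {S T : Module.End ℂ Db} (h : ∀ a, S (boson a) = T (boson a)) : S = T := by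
  apply Finsupp.lhom_ext'
  intro a
  apply LinearMap.ext_ring
  exact h a

theorem c_pos (k : ℕ+) : c (k : ℤ) = lower k := by
  obtain ⟨j, rfl⟩ : ∃ j : ℕ, k = j.succPNat := ⟨k.natPred, by simp⟩
  rfl

theorem c_neg (k : ℕ+) : c (-(k : ℤ)) = raise k := by
  obtain ⟨j, rfl⟩ : ∃ j : ℕ, k = j.succPNat := ⟨k.natPred, by simp⟩
  rfl

/-- Diagonal operators. -/
noncomputable def diagOp (d : Label → ℂ) : Module.End ℂ Db := ofBoson fun a => d a • boson a

theorem diagOp_apply (d : Label → ℂ) (v : Db) (a : Label) : diagOp d v a = d a * v a := by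
  induction v using Finsupp.induction_linear with
  | zero => simp
  | add f g hf hg => simp [hf, hg, mul_add]
  | single b z =>
    by_cases h : b = a
    · subst h; simp [diagOp, ofBoson, boson, mul_comm]
    · simp [diagOp, ofBoson, boson, h]

theorem diagOp_injective {d : Label → ℂ} (hd : ∀ a, d a ≠ 0) :
    Function.Injective (diagOp d) := by
  intro v w h
  ext a
  have := congrArg (fun u : Db => u a) h
  simpa [diagOp_apply, hd a] using this

theorem diagOp_boson (d : Label → ℂ) (a : Label) : diagOp d (boson a) = d a • boson a := by
  simp [diagOp, ofBoson_boson]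

theorem diagOp_locSum {ι : Type} {d : Label → ℂ} (hd : ∀ a, d a ≠ 0)
    {S T : ι → Module.End ℂ Db} (h : ∀ i, diagOp d * S i = T i * diagOp d) :
    diagOp d * locSum S = locSum T * diagOp d := by
  apply end_ext
  intro a
  have h1 : ∀ i, diagOp d (S i (boson a)) = d a • T i (boson a) := by
    intro i
    have := congrArg (fun U : Module.End ℂ Db => U (boson a)) (h i)
    simpa [diagOp_boson] using this
  simp only [Module.End.mul_apply, diagOp_boson, map_smul, locSum, ofBoson_boson]
  rw [show diagOp d (∑ᶠ i, S i (boson a)) = ∑ᶠ i, diagOp d (S i (boson a)) from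
    AddMonoidHom.map_finsum_of_injective (diagOp d).toAddMonoidHom (diagOp_injective hd) _]
  simp only [h1]
  exact (smul_finsum (d a) _).symm

theorem diagOp_expOp {d : Label → ℂ} (hd : ∀ a, d a ≠ 0) {S T : Module.End ℂ Db}
    (h : diagOp d * S = T * diagOp d) : diagOp d * expOp S = expOp T * diagOp d := by
  apply diagOp_locSum hd
  intro p
  have hp : diagOp d * S ^ p = T ^ p * diagOp d := by
    induction p with
    | zero => simp
    | succ p ih => rw [pow_succ, ← mul_assoc, ih, mul_assoc, h, ← mul_assoc, ← pow_succ]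
  rw [mul_smul_comm, hp, smul_mul_assoc]

theorem diagOp_c {d : Label → ℂ} (n : ℕ+) (w : ℂ)
    (h : ∀ a : Label, a.2 n ≠ 0 → d (a.1, a.2 - Finsupp.single n 1) = w * d a) :
    diagOp d * c n = w • (c n * diagOp d) := by
  apply end_ext
  intro a
  simp only [Module.End.mul_apply, LinearMap.smul_apply, diagOp_boson, map_smul, c_pos, lower,
    ofBoson_boson]
  by_cases ha : a.2 n = 0
  · simp [ha]
  · rw [h a ha]
    simp only [smul_smul]
    congr 1
    ring

/-- The degree `∑ₖ k mₖ`. -/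
def deg (m : ℕ+ →₀ ℕ) : ℕ := m.sum fun k j => (k : ℕ) * j

theorem deg_sub (m : ℕ+ →₀ ℕ) (n : ℕ+) (h : m n ≠ 0) :
    deg (m - Finsupp.single n 1) + n = deg m := by
  have hm : m = (m - Finsupp.single n 1) + Finsupp.single n 1 := by
    ext k
    by_cases hk : k = n
    · subst hk; simp; omega
    · simp [Ne.symm hk]
  conv_rhs => rw [hm]
  simp only [deg]
  rw [Finsupp.sum_add_index' (by simp) (by intros; ring)]
  simp

theorem finite_deg (D : ℕ) : {m : ℕ+ →₀ ℕ | deg m = D}.Finite := by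
  refine (Set.finite_Iic (∑ k ∈ Finset.range D, Finsupp.single k.succPNat D)).subset ?_
  intro m hm k
  simp only [Set.mem_ofPred_eq] at hm
  by_cases hk : m k = 0
  · simp [hk]
  · have h1 : (k : ℕ) * m k ≤ D := by
      rw [← hm, deg, Finsupp.sum]
      exact Finset.single_le_sum (f := fun k : ℕ+ => (k : ℕ) * m k) (fun _ _ => Nat.zero_le _)
        (Finsupp.mem_support_iff.2 hk)
    have h2 : m k ≤ D := le_trans (Nat.le_mul_of_pos_left _ k.pos) h1
    have h3 : (k : ℕ) ≤ D := le_trans (Nat.le_mul_of_pos_right _ (Nat.pos_of_ne_zero hk)) h1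
    refine h2.trans ?_
    rw [Finsupp.finsetSum_apply]
    have h4 : k.natPred ∈ Finset.range D := by
      have := k.natPred_add_one
      simp only [Finset.mem_range]
      omega
    refine le_trans ?_ (Finset.single_le_sum (fun _ _ => Nat.zero_le _) h4)
    simp

/-- The operator `e^{i y deg}`. -/
noncomputable def degOp (y : ℂ) : Module.End ℂ Db :=
  diagOp fun a => Complex.exp (Complex.I * y * deg a.2)

theorem degOp_expOp (y x ν : ℂ) :
    degOp y * expOp (ν • annField (x + y)) = expOp (ν • annField x) * degOp y := by
  apply diagOp_expOp (fun _ => Complex.exp_ne_zero _)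
  rw [mul_smul_comm, smul_mul_assoc]
  congr 1
  apply diagOp_locSum (fun _ => Complex.exp_ne_zero _)
  intro n
  rw [mul_smul_comm, smul_mul_assoc, diagOp_c n (Complex.exp (-(Complex.I * y * n))), smul_smul]
  · congr 1
    rw [div_mul_eq_mul_div, ← Complex.exp_add]
    congr 2
    ring
  · intro a ha
    rw [← Complex.exp_add, ← deg_sub a.2 n ha]
    congr 1
    push_cast
    ring

theorem expCharge_expOp (ν₀ : ℝ) (z x ν : ℂ) :
    expCharge ν₀ z * expOp (ν • annField x) = expOp (ν • annField x) * expCharge ν₀ z := by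
  apply diagOp_expOp (fun _ => Complex.exp_ne_zero _)
  rw [mul_smul_comm, smul_mul_assoc]
  congr 1
  apply diagOp_locSum (fun _ => Complex.exp_ne_zero _)
  intro n
  rw [mul_smul_comm, smul_mul_assoc, diagOp_c n 1 (by simp), one_smul]

theorem ip_eq_sum (v w : Db) {s : Finset Label} (hs : v.support ⊆ s) :
    ip v w = ∑ a ∈ s, (starRingEnd ℂ) (v a) * w a :=
  Finsupp.sum_of_support_subset _ hs _ (by simp)

theorem ip_diagOp (d e : Label → ℂ) (h : ∀ a, (starRingEnd ℂ) (d a) = e a) (v w : Db) :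
    ip (diagOp d v) w = ip v (diagOp e w) := by
  classical
  rw [ip_eq_sum (diagOp d v) w (s := v.support), ip_eq_sum v _ (s := v.support) (by rfl)]
  · refine Finset.sum_congr rfl fun a _ => ?_
    rw [diagOp_apply, diagOp_apply, map_mul, h]
    ring
  · intro a ha
    simp only [Finsupp.mem_support_iff, diagOp_apply] at ha ⊢
    exact right_ne_zero_of_mul ha

theorem ip_smul_left (z : ℂ) (v w : Db) : ip (z • v) w = (starRingEnd ℂ) z * ip v w := by
  classical
  rw [ip_eq_sum (z • v) w (s := v.support) (Finsupp.support_smul),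
    ip_eq_sum v w (s := v.support) (by rfl), Finset.mul_sum]
  refine Finset.sum_congr rfl fun a _ => ?_
  simp [mul_assoc]

theorem ip_smul_right (z : ℂ) (v w : Db) : ip v (z • w) = z * ip v w := by
  rw [ip_eq_sum v _ (by rfl), ip_eq_sum v w (by rfl), Finset.mul_sum]
  refine Finset.sum_congr rfl fun a _ => ?_
  simp
  ring

theorem expCharge_add (ν₀ : ℝ) (z w : ℂ) :
    expCharge ν₀ z * expCharge ν₀ w = expCharge ν₀ (z + w) := by
  apply end_ext
  intro a
  simp only [Module.End.mul_apply, expCharge, ofBoson_boson, map_smul, smul_smul]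
  rw [← Complex.exp_add]
  ring_nf

theorem expCharge_zero (ν₀ : ℝ) : expCharge ν₀ 0 = 1 := by
  apply end_ext
  intro a
  simp [expCharge, ofBoson_boson]

theorem ip_expCharge (ν₀ : ℝ) (z : ℂ) (v w : Db) :
    ip (expCharge ν₀ ((starRingEnd ℂ) z) v) w = ip v (expCharge ν₀ z w) := by
  apply ip_diagOp
  intro a
  rw [← Complex.exp_conj]
  simp

/-- The charge exponentials cancel in the periodic vertex operator. -/
theorem periodicVertexForm_eq (ν₀ : ℝ) (k : ℤ) (x : ℂ) (v w : Db) :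
    periodicVertexForm ν₀ k x v w =
      ip (expOp (((k : ℂ) * ν₀) • annField ((starRingEnd ℂ) x)) v)
        (Rpow k (expOp (-((k : ℂ) * ν₀) • annField x) w)) := by
  have key : ∀ (z y μ : ℂ) (u : Db), expOp (μ • annField y) (expCharge ν₀ z u) =
      expCharge ν₀ z (expOp (μ • annField y) u) := fun z y μ u =>
    congrArg (fun U : Module.End ℂ Db => U u) (expCharge_expOp ν₀ z y μ).symm
  have add : ∀ (z w : ℂ) (u : Db), expCharge ν₀ z (expCharge ν₀ w u) = expCharge ν₀ (z + w) u :=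
    fun z w u => congrArg (fun U : Module.End ℂ Db => U u) (expCharge_add ν₀ z w)
  have hz : -(Complex.I * ((k : ℂ) * ν₀) * (starRingEnd ℂ) x / 2) =
      (starRingEnd ℂ) (Complex.I * ((k : ℂ) * ν₀) * x / 2) := by
    simp [neg_div, map_div₀, map_ofNat]
  simp only [periodicVertexForm, vertexForm]
  rw [key, key, hz, ip_expCharge, add, add]
  simp [expCharge_zero]

/-- The matrix elements of the periodic vertex operator are monomials in `e^{ix}`. -/
theorem periodicVertexForm_boson (ν₀ : ℝ) (k : ℤ) (x : ℂ) (a b : Label) :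
    periodicVertexForm ν₀ k x (boson a) (boson b) =
      Complex.exp (Complex.I * ((deg b.2 : ℤ) - deg a.2 : ℤ) * x) *
        periodicVertexForm ν₀ k 0 (boson a) (boson b) := by
  have key : ∀ (μ y : ℂ) (e : Label), expOp (μ • annField y) (boson e) =
      Complex.exp (Complex.I * y * deg e.2) •
        degOp (-y) (expOp (μ • annField 0) (boson e)) := by
    intro μ y e
    have h := congrArg (fun U : Module.End ℂ Db => U (degOp y (boson e)))
      (degOp_expOp (-y) y μ)
    have h1 : degOp (-y) (degOp y (boson e)) = boson e := by
      simp only [degOp, diagOp_boson, map_smul, smul_smul]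
      rw [← Complex.exp_add]
      simp
    simp only [Module.End.mul_apply, h1, add_neg_cancel] at h
    rw [← h, degOp, degOp, diagOp_boson, map_smul, map_smul]
  have hR : ∀ (y : ℂ) (u : Db), Rpow k (degOp y u) = degOp y (Rpow k u) := by
    intro y u
    have : Rpow k * degOp y = degOp y * Rpow k := by
      apply end_ext
      intro e
      simp [Rpow, degOp, diagOp_boson, ofBoson_boson]
    exact congrArg (fun U : Module.End ℂ Db => U u) this
  rw [periodicVertexForm_eq, periodicVertexForm_eq, key, key (-_) x, map_smul, hR, ip_smul_left,
    ip_smul_right]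
  have hd : ∀ v w : Db, ip (degOp (-(starRingEnd ℂ) x) v) (degOp (-x) w) = ip v w := by
    intro v w
    rw [degOp, ip_diagOp _ (fun e => Complex.exp (Complex.I * x * deg e.2))]
    · congr 1
      ext e
      rw [degOp, diagOp_apply, diagOp_apply, ← mul_assoc, ← Complex.exp_add]
      simp
    · intro e
      rw [← Complex.exp_conj]
      simp
  rw [hd, ← Complex.exp_conj, ← mul_assoc, ← Complex.exp_add, map_zero]
  congr 2
  simp
  ring

theorem integral_mode (N : ℤ) (ε : ℝ) :
    (1 / (2 * (Real.pi : ℂ))) * ∫ t in (-Real.pi)..Real.pi,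
      Complex.exp (Complex.I * N * (t - ε * Complex.I)) = if N = 0 then 1 else 0 := by
  have hpi : (Real.pi : ℂ) ≠ 0 := by exact_mod_cast Real.pi_ne_zero
  split_ifs with h
  · subst h
    simp
    field_simp
    ring
  · have hN : (Complex.I * N : ℂ) ≠ 0 := mul_ne_zero Complex.I_ne_zero (by exact_mod_cast h)
    have h1 : ∀ t : ℝ, Complex.exp (Complex.I * N * (t - ε * Complex.I)) =
        Complex.exp (-(Complex.I * N * (ε * Complex.I))) * Complex.exp (Complex.I * N * t) := by
      intro t
      rw [← Complex.exp_add]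
      ring_nf
    simp only [h1]
    rw [intervalIntegral.integral_const_mul, integral_exp_mul_complex hN]
    have h2 : Complex.exp (Complex.I * N * (Real.pi : ℝ)) =
        Complex.exp (Complex.I * N * ((-Real.pi : ℝ) : ℂ)) := by
      rw [Complex.exp_eq_exp_iff_exists_int]
      exact ⟨N, by push_cast; ring⟩
    rw [h2]
    simp

/-- The Fourier modes are well-defined operators on the finite linear combinations of boson
states, independent of the height `ε` of the contour. -/
theorem existsUnique_fourierMode (ν₀ : ℝ) (k n : ℤ) :
    ∃! T : Module.End ℂ Db, IsFourierMode ν₀ k n T := by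
  classical
  have hint : ∀ (ε : ℝ) (a b : Label), (1 / (2 * (Real.pi : ℂ))) *
      (∫ t in (-Real.pi)..Real.pi,
        periodicVertexForm ν₀ k (t - ε * Complex.I) (boson a) (boson b) *
          Complex.exp (Complex.I * n * (t - ε * Complex.I))) =
      if (deg a.2 : ℤ) = deg b.2 + n then periodicVertexForm ν₀ k 0 (boson a) (boson b)
        else 0 := by
    intro ε a b
    have h1 : ∀ t : ℝ, periodicVertexForm ν₀ k (t - ε * Complex.I) (boson a) (boson b) *
          Complex.exp (Complex.I * n * (t - ε * Complex.I)) =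
        periodicVertexForm ν₀ k 0 (boson a) (boson b) *
          Complex.exp (Complex.I * ((deg b.2 : ℤ) - deg a.2 + n : ℤ) * (t - ε * Complex.I)) := by
      intro t
      rw [periodicVertexForm_boson, mul_comm (Complex.exp _) (periodicVertexForm _ _ _ _ _),
        mul_assoc, ← Complex.exp_add]
      congr 2
      push_cast
      ring
    simp only [h1]
    rw [intervalIntegral.integral_const_mul, mul_left_comm, integral_mode]
    have : ((deg b.2 : ℤ) - deg a.2 + n = 0) ↔ ((deg a.2 : ℤ) = deg b.2 + n) := by
      constructor <;> intro h <;> linarith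
    simp [this]
  have hR : ∀ (v w : Db) (e : Label), (∀ f ∈ w.support, f.1 = e.1) →
      ∀ f ∈ (Rpow k w).support, f.1 = e.1 + k := by
    intro v w e hw f hf
    rw [Rpow, ofBoson, Finsupp.linearCombination_apply, Finsupp.sum] at hf
    obtain ⟨g, hg, hg'⟩ := Finset.mem_biUnion.1 (Finsupp.support_finsetSum hf)
    have := Finsupp.support_single_subset (Finsupp.support_smul hg')
    rw [Finset.mem_singleton.1 this]
    simp [hw g hg]
  -- vectors of definite charge
  have hch : ∀ (y μ : ℂ) (e f : Label), f ∈ (expOp (μ • annField y) (boson e)).support →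
      f.1 = e.1 := by
    intro y μ e f hf
    have hcomm := diagOp_expOp (d := fun g : Label => if g.1 = e.1 then 1 else 2)
      (S := μ • annField y) (T := μ • annField y) (by intro g; split_ifs <;> norm_num) (by
        rw [mul_smul_comm, smul_mul_assoc]
        congr 1
        apply diagOp_locSum (by intro g; split_ifs <;> norm_num)
        intro i
        rw [mul_smul_comm, smul_mul_assoc, diagOp_c i 1 (by simp), one_smul])
    have h2 := congrArg (fun U : Module.End ℂ Db => U (boson e) f) hcomm
    simp only [Module.End.mul_apply, diagOp_apply, diagOp_boson, if_true, one_smul] at h2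
    by_contra hne
    rw [if_neg hne] at h2
    have h3 : expOp (μ • annField y) (boson e) f = 0 := by linear_combination h2
    exact (Finsupp.mem_support_iff.1 hf) h3
  have hzero : ∀ a b : Label, a.1 ≠ b.1 + k →
      periodicVertexForm ν₀ k 0 (boson a) (boson b) = 0 := by
    intro a b hab
    rw [periodicVertexForm_eq, ip, Finsupp.sum]
    refine Finset.sum_eq_zero fun f hf => ?_
    have h1 := hch _ _ _ _ hf
    by_contra hne
    have h2 := right_ne_zero_of_mul hne
    have h3 := hR 0 _ b (fun g hg => hch _ _ _ _ hg) f (Finsupp.mem_support_iff.2 h2)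
    exact hab (h1 ▸ h3)
  have hfin : ∀ b : Label, (Function.support fun a : Label =>
      if (deg a.2 : ℤ) = deg b.2 + n then periodicVertexForm ν₀ k 0 (boson a) (boson b)
        else 0).Finite := by
    intro b
    refine ((Set.finite_singleton (b.1 + k)).prod
      (finite_deg ((deg b.2 : ℤ) + n).toNat)).subset ?_
    intro a ha
    simp only [Function.mem_support, ne_eq, ite_eq_right_iff, not_forall] at ha
    obtain ⟨h1, h2⟩ := ha
    refine ⟨?_, ?_⟩
    · by_contra h
      exact h2 (hzero a b h)
    · simp only [Set.mem_ofPred_eq]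
      omega
  refine ⟨ofBoson fun b => Finsupp.ofSupportFinite _ (hfin b), ?_, ?_⟩
  · intro ε _ a b
    rw [ofBoson_boson, hint]
    rfl
  · intro T hT
    apply end_ext
    intro b
    ext a
    rw [hT 1 one_pos a b, ofBoson_boson, hint]
    rfl

/-! ### The anyon states -/

/-- The Fourier mode `φ̂_ν(n)` of the vertex operator with statistics parameter `ν = k ν₀`. -/
noncomputable def phiHat (ν₀ : ℝ) (k n : ℤ) : Module.End ℂ Db :=
  (existsUnique_fourierMode ν₀ k n).choose

/-- The anyon state
`η(n) = φ̂_ν(n₁) ⋯ φ̂_ν(n_N) φ̂_{-1/ν}(n_{N+1}) ⋯ φ̂_{-1/ν}(n_{N+M}) |Q⟩`, where `ν = r ν₀` and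
`1/ν = s ν₀`. -/
noncomputable def eta (ν₀ : ℝ) (r s N M : ℕ) (Q : ℤ) (n : Fin (N + M) → ℤ) : Db :=
  (List.ofFn fun j : Fin (N + M) =>
    phiHat ν₀ (if (j : ℕ) < N then (r : ℤ) else -(s : ℤ)) (n j)).prod (charged Q)

/-! ### Eigenvalues and the recursion -/

/-- The pseudo-momenta `n⁺_j`; the index `j` is counted from `0`. -/
noncomputable def nplus (ν₀ ν : ℝ) (N M : ℕ) (Q : ℤ) (n : Fin (N + M) → ℤ)
    (j : Fin (N + M)) : ℝ :=
  if (j : ℕ) < N then n j + ν ^ 2 * (N + 1 / 2 - (((j : ℕ) : ℝ) + 1)) - M + ν * ν₀ * Q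
  else n j + (ν ^ 2)⁻¹ * (M + 1 / 2 - (((j : ℕ) : ℝ) + 1 - N)) - ν⁻¹ * ν₀ * Q

/-- The eigenvalue of `H^{ν,1}`. -/
noncomputable def E1 (ν₀ ν : ℝ) (N M : ℕ) (Q : ℤ) : ℝ := (N - (ν ^ 2)⁻¹ * M) + ν⁻¹ * ν₀ * Q

/-- The eigenvalue of `H^{ν,2}`. -/
noncomputable def E2 (ν₀ ν : ℝ) (N M : ℕ) (Q : ℤ) (n : Fin (N + M) → ℤ) : ℝ :=
  ∑ j, nplus ν₀ ν N M Q n j + 1 / 2 * (ν₀ * Q) ^ 2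

/-- The eigenvalue of `H^{ν,3}`. -/
noncomputable def E3 (ν₀ ν : ℝ) (N M : ℕ) (Q : ℤ) (n : Fin (N + M) → ℤ) : ℝ :=
  ∑ j : Fin (N + M), (if (j : ℕ) < N then 1 else -ν ^ 2) * nplus ν₀ ν N M Q n j ^ 2
    + 1 / 12 * (ν ^ 2 - (ν ^ 2)⁻¹) * M + ν * (ν₀ * Q) ^ 3 / 3 - ν ^ 3 * (ν₀ * Q) / 12

/-- The coefficients `γ_{jk} = ν ν_k (ν_j² - 1)`, where `ν_j = ν` for the first `N` indices and
`ν_j = -1/ν` for the others. -/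
noncomputable def gam (ν : ℝ) (N M : ℕ) (j k : Fin (N + M)) : ℝ :=
  let νv : Fin (N + M) → ℝ := fun i => if (i : ℕ) < N then ν else -ν⁻¹
  ν * νv k * (νv j ^ 2 - 1)

/-- The tail sum `m_j + ⋯ + m_{N+M}`. -/
def tailSum {K : ℕ} (m : Fin K → ℤ) (j : Fin K) : ℤ := ∑ k ∈ Finset.Ici j, m k

/-- The partial order `m ⪯ n`. -/
def PLe {K : ℕ} (m n : Fin K → ℤ) : Prop := ∀ j, tailSum m j ≤ tailSum n j

/-- The strict order `m ≺ n`. -/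
def PLt {K : ℕ} (m n : Fin K → ℤ) : Prop := PLe m n ∧ m ≠ n

/-- The vector `e_j - e_k`. -/
def rootVec {K : ℕ} (j k : Fin K) : Fin K → ℤ := Pi.single j 1 - Pi.single k 1

/-- `m = n + ∑_{j<k} μ_{jk} (e_j - e_k)` with non-negative integers `μ_{jk}`. -/
def IsRaised {K : ℕ} (n m : Fin K → ℤ) : Prop :=
  ∃ μ : Fin K → Fin K → ℕ, m = n + ∑ j, ∑ k ∈ Finset.Ioi j, (μ j k : ℤ) • rootVec j k

/-- The vectors that occur in the recursion: those reached from `n` all of whose tail sums are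
non-negative. -/
def Occurs {K : ℕ} (n m : Fin K → ℤ) : Prop := IsRaised n m ∧ ∀ j, 0 ≤ tailSum m j

/-- The eigenvalue differences `b_n(m)`. -/
noncomputable def bdiff (ν₀ ν : ℝ) (N M : ℕ) (Q : ℤ) (n m : Fin (N + M) → ℤ) : ℝ :=
  E3 ν₀ ν N M Q m - E3 ν₀ ν N M Q n

/-- The non-degeneracy condition on `n`. -/
def NonDegenerate (ν₀ ν : ℝ) (N M : ℕ) (Q : ℤ) (n : Fin (N + M) → ℤ) : Prop :=
  ∀ m, Occurs n m → m ≠ n → bdiff ν₀ ν N M Q n m ≠ 0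

/-- The restrictions `s - r ≥ Q ≥ 1 - r`, `n₁ ≥ ⋯ ≥ n_N ≥ M + χ_{Q>0}`,
`n_{N+1} ≥ ⋯ ≥ n_{N+M} ≥ 0`. -/
def Restricted (r s N M : ℕ) (Q : ℤ) (n : Fin (N + M) → ℤ) : Prop :=
  Q ≤ (s : ℤ) - r ∧ 1 - (r : ℤ) ≤ Q ∧
  (∀ i j : Fin (N + M), i ≤ j → (j : ℕ) < N → n j ≤ n i) ∧
  (∀ j : Fin (N + M), (j : ℕ) < N → (M : ℤ) + (if 0 < Q then 1 else 0) ≤ n j) ∧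
  (∀ i j : Fin (N + M), i ≤ j → N ≤ (i : ℕ) → n j ≤ n i) ∧
  (∀ j : Fin (N + M), N ≤ (j : ℕ) → 0 ≤ n j)

/-- The triangular recursion for the coefficients `u_n(m)`. -/
def IsRecursive (ν₀ ν : ℝ) (N M : ℕ) (Q : ℤ) (n : Fin (N + M) → ℤ)
    (u : (Fin (N + M) → ℤ) → ℂ) : Prop :=
  (∀ m, PLt n m → u m = 0) ∧
  u n = 1 ∧
  (∀ m, Occurs n m → m ≠ n →
    u m = ((2 / bdiff ν₀ ν N M Q n m : ℝ) : ℂ) *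
      ∑ j, ∑ k ∈ Finset.Ioi j, (gam ν N M j k : ℂ) *
        ∑ᶠ μ : ℕ+, (μ : ℂ) * u (m - (μ : ℤ) • rootVec j k)) ∧
  (∀ m, ¬ Occurs n m → m ≠ n → u m = 0)

/-- The state `η(n) + ∑_{m ≺ n} u(m) η(m)`. -/
noncomputable def psiTilde (ν₀ : ℝ) (r s N M : ℕ) (Q : ℤ) (n : Fin (N + M) → ℤ)
    (u : (Fin (N + M) → ℤ) → ℂ) : Db :=
  eta ν₀ r s N M Q n + ∑ᶠ (m) (_ : PLt m n), u m • eta ν₀ r s N M Q m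

end AnyonCFT

namespace AnyonCFT

/-! ### Operators and spaces spanned by boson states -/

/-! Everything rests on one commutator. Each `c n` lowers the degree by `n`, and no state has
negative degree, so the infinite mode sums are finite on any given state. Moving `c n` past the
exponentials of the vertex operator gives `[c n, phiHat m] = μ phiHat (m - n)` for `n ≠ 0`, where `μ
= k ν₀` (`c_phiHat`).

From this `H3_commutator` computes the commutator of `H3` with `phiHat m`. The terms quadratic in
the `c`'s are traded for `m²` by the second-derivative identity `mode_sq_smul_phiHat`. The remaining
creation terms `∑ n c₋ₙ phiHat (m - n)` carry the coefficient `ν μ² - ν + (1 - ν²) μ`, whose roots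
in `μ` are `ν` and `-1/ν`; this is why these two kinds of vertex operators occur. A scalar and the
annihilation terms `∑ n phiHat (m + n) cₙ` survive. Pushing `cₙ` to the right until it kills `|Q⟩`
yields (`H3_chain`, `H3_eta`) `H3 η(m) = E3(m) η(m) - 2 ∑_{j<k} γ_{jk} ∑_{i≥1} i η(m + i (e_j -
e_k))`.

So `H3` is triangular on the `η(m)`. Since `η(m) = 0` once a tail sum is negative (`chain_eq_zero`),
only finitely many vectors matter. The recursion says that the coefficient of every `η(m)` in `(H3 -
E3(n)) ψ` vanishes, and it is solved by induction on `height`. `H1` and `H2` only see charge and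
degree, which raising preserves.

For the non-degeneracy criterion, `E3` is, up to constants, a signed sum of squares of
pseudo-momenta. With one kind of particle these are decreasing along the index, and raising strictly
increases their sum of squares (`IsRaised.sum_sq_lt`); for one particle of each kind the difference
is an explicit positive number. -/

theorem map_mem_supported {T : Module.End ℂ Db} {s t : Set Label}
    (h : ∀ a ∈ s, T (boson a) ∈ Finsupp.supported ℂ ℂ t) {v : Db}
    (hv : v ∈ Finsupp.supported ℂ ℂ s) : T v ∈ Finsupp.supported ℂ ℂ t := by
  rw [Finsupp.supported_eq_span_single] at hv
  induction hv using Submodule.span_induction with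
  | mem x hx => obtain ⟨a, ha, rfl⟩ := hx; exact h a ha
  | zero => simp
  | add x y _ _ hx hy => rw [map_add]; exact add_mem hx hy
  | smul z x _ hx => rw [map_smul]; exact Submodule.smul_mem _ z hx

theorem eqOn_supported {S T : Module.End ℂ Db} {s : Set Label}
    (h : ∀ a ∈ s, S (boson a) = T (boson a)) {v : Db}
    (hv : v ∈ Finsupp.supported ℂ ℂ s) : S v = T v := by
  rw [Finsupp.supported_eq_span_single] at hv
  induction hv using Submodule.span_induction with
  | mem x hx => obtain ⟨a, ha, rfl⟩ := hx; exact h a ha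
  | zero => simp
  | add x y _ _ hx hy => rw [map_add, map_add, hx, hy]
  | smul z x _ hx => rw [map_smul, map_smul, hx]

/-- One finite index set that serves all labels in `s` replaces the separate `finsum` at each label
by a sum of operators. All cutoffs below enter through this. -/
theorem locSum_apply {ι : Type} {T : ι → Module.End ℂ Db} {s : Set Label} {F : Finset ι}
    (h : ∀ a ∈ s, ∀ i, i ∉ F → T i (boson a) = 0) {v : Db}
    (hv : v ∈ Finsupp.supported ℂ ℂ s) : locSum T v = ∑ i ∈ F, T i v := by
  have : locSum T v = (∑ i ∈ F, T i) v := by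
    refine eqOn_supported (fun a ha => ?_) hv
    rw [locSum, ofBoson_boson, LinearMap.sum_apply]
    refine finsum_eq_sum_of_support_subset _ fun i hi => ?_
    by_contra hF
    exact hi (h a ha i hF)
  rw [this, LinearMap.sum_apply]

/-- The states of charge `q` and degree `d`. -/
noncomputable def graded (q d : ℤ) : Submodule ℂ Db :=
  Finsupp.supported ℂ ℂ {a : Label | a.1 = q ∧ (deg a.2 : ℤ) = d}

/-- The states of degree at most `d`. -/
noncomputable def filt (d : ℤ) : Submodule ℂ Db :=
  Finsupp.supported ℂ ℂ {a : Label | (deg a.2 : ℤ) ≤ d}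

theorem boson_mem {a : Label} {s : Set Label} (h : a ∈ s) :
    boson a ∈ Finsupp.supported ℂ ℂ s :=
  Finsupp.single_mem_supported ℂ _ h

theorem boson_mem_graded (a : Label) : boson a ∈ graded a.1 (deg a.2) :=
  boson_mem ⟨rfl, rfl⟩

theorem boson_mem_filt {a : Label} {d : ℤ} (h : (deg a.2 : ℤ) ≤ d) : boson a ∈ filt d :=
  boson_mem h

theorem graded_le_filt {q d e : ℤ} (h : d ≤ e) : graded q d ≤ filt e :=
  Finsupp.supported_mono fun _ ha => ha.2.le.trans h

theorem filt_mono {d e : ℤ} (h : d ≤ e) : filt d ≤ filt e :=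
  Finsupp.supported_mono fun _ ha => le_trans ha h

/-- Degrees are natural numbers. Every truncation of a mode sum comes from this. -/
theorem eq_zero_of_mem_filt {d : ℤ} (hd : d < 0) {v : Db} (hv : v ∈ filt d) : v = 0 := by
  have : {a : Label | (deg a.2 : ℤ) ≤ d} = ∅ := by
    ext a
    simp only [Set.mem_ofPred_eq, Set.mem_empty_iff_false, iff_false]
    omega
  rwa [filt, this, Finsupp.supported_empty, Submodule.mem_bot] at hv

theorem eq_zero_of_mem_graded {q d : ℤ} (hd : d < 0) {v : Db} (hv : v ∈ graded q d) : v = 0 :=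
  eq_zero_of_mem_filt hd (graded_le_filt le_rfl hv)

theorem exists_mem_filt (v : Db) : ∃ d : ℕ, v ∈ filt d := by
  refine ⟨v.support.sup fun a => deg a.2, ?_⟩
  intro a ha
  simp only [Set.mem_ofPred_eq, Nat.cast_le]
  exact Finset.le_sup (f := fun a : Label => deg a.2) ha

theorem int_trichotomy (n : ℤ) : n = 0 ∨ (∃ k : ℕ+, n = k) ∨ ∃ k : ℕ+, n = -(k : ℤ) := by
  rcases lt_trichotomy n 0 with h | h | h
  · exact Or.inr (Or.inr ⟨⟨(-n).toNat, by omega⟩, by simp only [PNat.mk_coe]; omega⟩)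
  · exact Or.inl h
  · exact Or.inr (Or.inl ⟨⟨n.toNat, by omega⟩, by simp only [PNat.mk_coe]; omega⟩)

theorem deg_add_single (m : ℕ+ →₀ ℕ) (n : ℕ+) : deg (m + Finsupp.single n 1) = deg m + n := by
  have := deg_sub (m + Finsupp.single n 1) n (by simp)
  rw [← this, add_tsub_cancel_right]

theorem c_zero_boson (a : Label) : c 0 (boson a) = (a.1 : ℂ) • boson a := ofBoson_boson _ _

theorem c_boson_mem (n : ℤ) (a : Label) : c n (boson a) ∈ graded a.1 (deg a.2 - n) := by
  rcases int_trichotomy n with rfl | ⟨k, rfl⟩ | ⟨k, rfl⟩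
  · rw [c_zero_boson, sub_zero]
    exact Submodule.smul_mem _ _ (boson_mem_graded a)
  · rw [c_pos, lower, ofBoson_boson]
    by_cases h : a.2 k = 0
    · simp [h]
    · refine Submodule.smul_mem _ _ (boson_mem ⟨rfl, ?_⟩)
      have := deg_sub a.2 k h
      dsimp only
      omega
  · rw [c_neg, raise, ofBoson_boson]
    refine Submodule.smul_mem _ _ (boson_mem ⟨rfl, ?_⟩)
    rw [deg_add_single]
    push_cast
    ring

theorem c_mem_graded (n : ℤ) {q d : ℤ} {v : Db} (hv : v ∈ graded q d) :
    c n v ∈ graded q (d - n) := by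
  refine map_mem_supported (fun a ha => ?_) hv
  have := c_boson_mem n a
  rwa [ha.1, ha.2] at this

theorem c_mem_filt (n : ℤ) {d : ℤ} {v : Db} (hv : v ∈ filt d) : c n v ∈ filt (d - n) := by
  refine map_mem_supported (fun a ha => ?_) hv
  refine graded_le_filt ?_ (c_boson_mem n a)
  simp only [Set.mem_ofPred_eq] at ha
  omega

theorem c_eq_zero {n d : ℤ} (h : d < n) {v : Db} (hv : v ∈ filt d) : c n v = 0 :=
  eq_zero_of_mem_filt (by omega) (c_mem_filt n hv)

theorem c_zero_apply {q d : ℤ} {v : Db} (hv : v ∈ graded q d) : c 0 v = (q : ℂ) • v := by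
  have := eqOn_supported (S := c 0) (T := (q : ℂ) • 1) (fun a ha => ?_) hv
  · simpa using this
  · rw [c_zero_boson, ha.1]; rfl

/-! ### Commutation relations of the modes -/

theorem lower_mul_lower (k l : ℕ+) : lower k * lower l = lower l * lower k := by
  by_cases hkl : k = l
  · rw [hkl]
  apply end_ext
  intro a
  simp only [Module.End.mul_apply, lower, ofBoson_boson, map_smul, smul_smul]
  simp only [Finsupp.tsub_apply, Finsupp.single_eq_of_ne hkl, tsub_zero,
    Finsupp.single_eq_of_ne (Ne.symm hkl), tsub_right_comm]
  rw [mul_comm, tsub_right_comm]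

theorem lower_mul_raise (k l : ℕ+) :
    lower k * raise l = raise l * lower k + (if k = l then (k : ℂ) else 0) • 1 := by
  apply end_ext
  intro a
  simp only [Module.End.mul_apply, LinearMap.add_apply, LinearMap.smul_apply, Module.End.one_apply,
    lower, raise, ofBoson_boson, map_smul, smul_smul]
  by_cases hkl : k = l
  · subst hkl
    simp only [if_true]
    have h0 : ∀ x : ℝ, 0 ≤ x → (((√x : ℝ) : ℂ)) * ((√x : ℝ) : ℂ) = (x : ℂ) := by
      intro x hx
      rw [← Complex.ofReal_mul, Real.mul_self_sqrt hx]
    simp only [Finsupp.add_apply, Finsupp.single_eq_same, add_tsub_cancel_right, Prod.mk.eta]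
    have h1 : (√((k : ℝ) * ((a.2 k : ℝ) + 1))) = √((k : ℝ) * ((a.2 k + 1 : ℕ) : ℝ)) := by
      push_cast; rfl
    rw [h1, h0 _ (by positivity)]
    -- For an empty mode the truncated subtraction in `lower` gives a wrong label, but its
    -- coefficient is `√0`.
    by_cases ha : a.2 k = 0
    · simp [ha]
    · have hle : Finsupp.single k 1 ≤ a.2 := by
        rw [Finsupp.single_le_iff]; omega
      rw [tsub_add_cancel_of_le hle, Finsupp.tsub_apply, Finsupp.single_eq_same]
      have h2 : ((a.2 k - 1 : ℕ) : ℝ) + 1 = a.2 k := by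
        have : 1 ≤ a.2 k := by omega
        push_cast [this]; ring
      rw [h2, h0 _ (by positivity), ← add_smul]
      congr 1
      push_cast
      ring
  · simp only [hkl, if_false, zero_smul, add_zero]
    by_cases ha : a.2 k = 0
    · simp [ha, Finsupp.single_eq_of_ne hkl]
    · have hle : Finsupp.single k 1 ≤ a.2 := by
        rw [Finsupp.single_le_iff]; omega
      rw [tsub_add_eq_add_tsub hle, mul_comm]
      simp [Finsupp.single_eq_of_ne hkl, Finsupp.single_eq_of_ne (Ne.symm hkl)]

theorem c_zero_comm (n : ℤ) : c 0 * c n = c n * c 0 := by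
  apply end_ext
  intro a
  rw [Module.End.mul_apply, Module.End.mul_apply, c_zero_apply (c_boson_mem n a), c_zero_boson,
    map_smul]

theorem c_comm_of_nonneg {n : ℤ} (hn : 0 ≤ n) (k : ℕ+) : c k * c n = c n * c k := by
  rcases int_trichotomy n with rfl | ⟨l, rfl⟩ | ⟨l, rfl⟩
  · exact (c_zero_comm k).symm
  · rw [c_pos, c_pos, lower_mul_lower]
  · have := l.pos
    omega

theorem c_comm_neg (k l : ℕ+) :
    c k * c (-(l : ℤ)) = c (-(l : ℤ)) * c k + (if k = l then (k : ℂ) else 0) • 1 := by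
  rw [c_pos, c_neg, lower_mul_raise]

/-! ### The inner product -/

theorem ip_add_left (u v w : Db) : ip (u + v) w = ip u w + ip v w :=
  Finsupp.sum_add_index' (by simp) (by intros; simp [add_mul])

theorem ip_add_right (u v w : Db) : ip u (v + w) = ip u v + ip u w := by
  simp [ip, mul_add, Finsupp.sum_add]

theorem ip_boson (a : Label) (w : Db) : ip (boson a) w = w a := by
  simp [ip, boson]

theorem ip_adjoint_of_boson {S T : Module.End ℂ Db}
    (h : ∀ a b, ip (S (boson a)) (boson b) = ip (boson a) (T (boson b))) (v w : Db) :
    ip (S v) w = ip v (T w) := by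
  induction v using Finsupp.induction_linear with
  | zero => simp [ip]
  | add f g hf hg => rw [map_add, ip_add_left, ip_add_left, hf, hg]
  | single a z =>
    induction w using Finsupp.induction_linear with
    | zero => simp [ip]
    | add f g hf hg => rw [map_add, ip_add_right, ip_add_right, hf, hg]
    | single b y =>
      have e1 : Finsupp.single a z = z • boson a := by simp [boson]
      have e2 : Finsupp.single b y = y • boson b := by simp [boson]
      rw [e1, e2, map_smul, map_smul, ip_smul_left, ip_smul_left, ip_smul_right, ip_smul_right, h]

theorem ip_lower (k : ℕ+) (v w : Db) : ip (lower k v) w = ip v (raise k w) := by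
  refine ip_adjoint_of_boson (fun a b => ?_) v w
  rw [lower, raise, ofBoson_boson, ofBoson_boson, ip_smul_left, ip_smul_right, ip_boson, ip_boson,
    Complex.conj_ofReal, boson, boson, Finsupp.single_apply, Finsupp.single_apply]
  by_cases ha : a.2 k = 0
  · have : (b.1, b.2 + Finsupp.single k 1) ≠ a := by
      rintro rfl
      simp at ha
    simp [ha, this]
  · have hle : Finsupp.single k 1 ≤ a.2 := by
      rw [Finsupp.single_le_iff]; omega
    have hiff : b = (a.1, a.2 - Finsupp.single k 1) ↔ (b.1, b.2 + Finsupp.single k 1) = a := by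
      constructor
      · rintro rfl
        simp [tsub_add_cancel_of_le hle]
      · rintro rfl
        simp
    by_cases hb : (b.1, b.2 + Finsupp.single k 1) = a
    · rw [if_pos hb, if_pos (hiff.2 hb)]
      subst hb
      simp
    · rw [if_neg hb, if_neg (fun h => hb (hiff.1 h))]
      simp

theorem ip_conj_symm (v w : Db) : (starRingEnd ℂ) (ip v w) = ip w v := by
  classical
  rw [ip_eq_sum v w (Finset.subset_union_left (s₂ := w.support)),
    ip_eq_sum w v (Finset.subset_union_right (s₁ := v.support)), map_sum]
  refine Finset.sum_congr rfl fun a _ => ?_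
  simp [mul_comm]

theorem ip_c (n : ℤ) (v w : Db) : ip (c n v) w = ip v (c (-n) w) := by
  rcases int_trichotomy n with rfl | ⟨k, rfl⟩ | ⟨k, rfl⟩
  · rw [neg_zero]
    exact ip_diagOp (fun a => (a.1 : ℂ)) (fun a => (a.1 : ℂ)) (by simp) v w
  · rw [c_pos, c_neg, ip_lower]
  · rw [neg_neg, c_pos, c_neg, ← ip_conj_symm, ← ip_lower, ip_conj_symm]

/-- The positive integers up to `P`. -/
def box (P : ℕ) : Finset ℕ+ := (Finset.range P).map ⟨Nat.succPNat, Nat.succPNat_injective⟩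

theorem mem_box {P : ℕ} {k : ℕ+} : k ∈ box P ↔ (k : ℕ) ≤ P := by
  simp only [box, Finset.mem_map, Finset.mem_range, Function.Embedding.coeFn_mk]
  constructor
  · rintro ⟨a, ha, rfl⟩
    simpa using ha
  · intro h
    refine ⟨k.natPred, ?_, by simp⟩
    have := k.natPred_add_one
    omega

/-! ### The exponential of the annihilation field -/

/-- The point `x = 0` suffices, because `periodicVertexForm_boson` moves the dependence on `x` into
a scalar. -/
theorem annField_zero_apply {d : ℤ} {v : Db} (hv : v ∈ filt d) {P : ℕ} (hP : d ≤ P) :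
    annField 0 v = ∑ n ∈ box P, ((n : ℂ)⁻¹) • c n v := by
  rw [annField, locSum_apply (F := box P) _ hv]
  · refine Finset.sum_congr rfl fun n _ => ?_
    simp
  · intro a ha i hi
    rw [LinearMap.smul_apply, c_eq_zero (d := d) _ (boson_mem_filt ha), smul_zero]
    rw [mem_box] at hi
    omega

theorem annField_zero_mem {d : ℤ} {v : Db} (hv : v ∈ filt d) : annField 0 v ∈ filt (d - 1) := by
  rw [annField_zero_apply hv (P := d.toNat) (by omega)]
  refine Submodule.sum_mem _ fun n _ => Submodule.smul_mem _ _ ?_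
  refine filt_mono ?_ (c_mem_filt n hv)
  have := n.pos
  omega

theorem annField_comm {n : ℤ} (hn : 0 ≤ n) : annField 0 * c n = c n * annField 0 := by
  apply end_ext
  intro b
  have hb : boson b ∈ filt (deg b.2) := boson_mem_filt le_rfl
  rw [Module.End.mul_apply, Module.End.mul_apply, annField_zero_apply hb le_rfl,
    annField_zero_apply (c_mem_filt n hb) (P := deg b.2) (by omega), map_sum]
  refine Finset.sum_congr rfl fun k _ => ?_
  rw [map_smul, ← Module.End.mul_apply, ← Module.End.mul_apply, c_comm_of_nonneg hn]

/-- The weight `1 / l` in the field cancels the central term `l` of `[c l, c (-l)]`. Hence all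
creation modes are shifted by the same scalar, whatever `l` is. -/
theorem annField_comm_neg (l : ℕ+) :
    annField 0 * c (-(l : ℤ)) = c (-(l : ℤ)) * annField 0 + 1 := by
  apply end_ext
  intro b
  have hb : boson b ∈ filt (deg b.2) := boson_mem_filt le_rfl
  rw [LinearMap.add_apply, Module.End.mul_apply, Module.End.mul_apply,
    annField_zero_apply hb (P := deg b.2 + l) (by push_cast; omega),
    annField_zero_apply (c_mem_filt _ hb) (P := deg b.2 + l) (by push_cast; omega), map_sum]
  have h : ∀ k : ℕ+, ((k : ℂ)⁻¹) • c k (c (-(l : ℤ)) (boson b)) =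
      c (-(l : ℤ)) (((k : ℂ)⁻¹) • c k (boson b)) + if k = l then boson b else 0 := by
    intro k
    rw [map_smul, ← Module.End.mul_apply, c_comm_neg, LinearMap.add_apply, smul_add]
    congr 1
    split_ifs with hk
    · subst hk
      simp
    · simp
  rw [Finset.sum_congr rfl fun k _ => h k, Finset.sum_add_distrib, Finset.sum_ite_eq',
    if_pos (mem_box.2 (by omega))]
  rfl

theorem annField_pow_mem {d : ℤ} {v : Db} (hv : v ∈ filt d) (p : ℕ) :
    (annField 0 ^ p) v ∈ filt (d - p) := by
  induction p with
  | zero => simpa using hv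
  | succ p ih =>
    rw [pow_succ', Module.End.mul_apply]
    have := annField_zero_mem ih
    refine filt_mono ?_ this
    push_cast
    omega

theorem annField_pow_comm_neg (l : ℕ+) (p : ℕ) :
    annField 0 ^ (p + 1) * c (-(l : ℤ)) =
      c (-(l : ℤ)) * annField 0 ^ (p + 1) + ((p + 1 : ℕ) : ℂ) • annField 0 ^ p := by
  induction p with
  | zero => simp [annField_comm_neg]
  | succ p ih =>
    rw [pow_succ', mul_assoc, ih, mul_add, ← mul_assoc, annField_comm_neg, add_mul, one_mul,
      mul_assoc, ← pow_succ', mul_smul_comm, ← pow_succ', add_assoc]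
    congr 1
    push_cast
    module

theorem expOp_apply (μ : ℂ) {d : ℤ} {v : Db} (hv : v ∈ filt d) {P : ℕ} (hP : d < P) :
    expOp (μ • annField 0) v =
      ∑ p ∈ Finset.range P, (((p.factorial : ℂ)⁻¹) * μ ^ p) • (annField 0 ^ p) v := by
  rw [expOp, locSum_apply (F := Finset.range P) _ hv]
  · refine Finset.sum_congr rfl fun p _ => ?_
    rw [smul_pow, LinearMap.smul_apply, LinearMap.smul_apply, smul_smul]
  · intro a ha i hi
    rw [smul_pow, LinearMap.smul_apply, LinearMap.smul_apply,
      eq_zero_of_mem_filt (d := d - i) _ (annField_pow_mem (boson_mem_filt ha) i), smul_zero,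
      smul_zero]
    simp only [Finset.mem_range] at hi
    omega

theorem expOp_comm (μ : ℂ) {n : ℤ} (hn : 0 ≤ n) (v : Db) :
    expOp (μ • annField 0) (c n v) = c n (expOp (μ • annField 0) v) := by
  obtain ⟨d, hv⟩ := exists_mem_filt v
  rw [expOp_apply μ hv (P := d + 1) (by simp),
    expOp_apply μ (c_mem_filt n hv) (P := d + 1) (by push_cast; omega), map_sum]
  refine Finset.sum_congr rfl fun p _ => ?_
  rw [map_smul, ← Module.End.mul_apply, ← Module.End.mul_apply]
  have : Commute (annField 0) (c n) := annField_comm hn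
  rw [(this.pow_left p).eq]

/-- The field has commutator `1` with `c (-l)`, so conjugation by its exponential translates `c
(-l)` by `μ`. -/
theorem expOp_comm_neg (μ : ℂ) (l : ℕ+) (v : Db) :
    expOp (μ • annField 0) (c (-(l : ℤ)) v) =
      c (-(l : ℤ)) (expOp (μ • annField 0) v) + μ • expOp (μ • annField 0) v := by
  obtain ⟨d, hv⟩ := exists_mem_filt v
  have hP : (d : ℤ) < ((d + l + 1 : ℕ) : ℤ) := by push_cast; omega
  have hP' : (d : ℤ) < ((d + l + 1 + 1 : ℕ) : ℤ) := by push_cast; omega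
  rw [expOp_apply μ (c_mem_filt _ hv) (P := d + l + 1 + 1) (by push_cast; omega)]
  -- The commutator lowers the power by one, so the two exponentials on the right are cut off at
  -- lengths differing by one.
  nth_rw 1 [expOp_apply μ hv hP']
  rw [expOp_apply μ hv hP, Finset.sum_range_succ' _ (d + l + 1),
    Finset.sum_range_succ' _ (d + l + 1), map_add, map_sum,
    Finset.smul_sum, add_right_comm (Finset.sum _ _), ← Finset.sum_add_distrib]
  congr 1
  · refine Finset.sum_congr rfl fun p _ => ?_
    rw [← Module.End.mul_apply, annField_pow_comm_neg, LinearMap.add_apply, smul_add, map_smul,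
      Module.End.mul_apply]
    congr 1
    rw [LinearMap.smul_apply, smul_smul, smul_smul, Nat.factorial_succ]
    congr 1
    have h1 : ((p + 1 : ℕ) : ℂ) ≠ 0 := by exact_mod_cast Nat.succ_ne_zero p
    have h2 : (p.factorial : ℂ) ≠ 0 := by exact_mod_cast p.factorial_ne_zero
    push_cast at h1 ⊢
    field_simp
    ring
  · simp

/-! ### Matrix elements of the vertex operator -/

/-- The matrix elements at `x = 0` of the vertex operator with statistics parameter `μ = k ν₀`. -/
noncomputable def vertexZero (ν₀ : ℝ) (k : ℤ) (v w : Db) : ℂ :=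
  ip (expOp (((k : ℂ) * ν₀) • annField 0) v) (Rpow k (expOp (-((k : ℂ) * ν₀) • annField 0) w))

theorem Rpow_c {n : ℤ} (hn : n ≠ 0) (k : ℤ) (v : Db) : Rpow k (c n v) = c n (Rpow k v) := by
  have : Rpow k * c n = c n * Rpow k := by
    apply end_ext
    intro a
    rcases int_trichotomy n with rfl | ⟨l, rfl⟩ | ⟨l, rfl⟩
    · exact absurd rfl hn
    · simp [c_pos, lower, Rpow, ofBoson_boson]
    · simp [c_neg, raise, Rpow, ofBoson_boson]
  exact LinearMap.congr_fun this v

theorem Rpow_c_zero (k : ℤ) (v : Db) : c 0 (Rpow k v) = Rpow k (c 0 v) + (k : ℂ) • Rpow k v := by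
  have : c 0 * Rpow k = Rpow k * c 0 + (k : ℂ) • Rpow k := by
    apply end_ext
    intro a
    simp [Rpow, ofBoson_boson, c_zero_boson, add_smul]
  exact LinearMap.congr_fun this v

/-- The commutator of `cₙ` with a vertex operator is a multiple of the latter by this number. -/
noncomputable def commCoeff (ν₀ : ℝ) (k n : ℤ) : ℂ := if n = 0 then k else (k : ℂ) * ν₀

/-- This is the commutator of `c n` with the vertex operator, written for the form. For `n = 0` the
term comes from `R ^ k`, for `n > 0` from the exponential on the left argument, for `n < 0` from the
one on the right argument. -/
theorem vertexZero_c (ν₀ : ℝ) (k n : ℤ) (v w : Db) :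
    vertexZero ν₀ k (c (-n) v) w - vertexZero ν₀ k v (c n w) =
      commCoeff ν₀ k n * vertexZero ν₀ k v w := by
  have hconj : (starRingEnd ℂ) ((k : ℂ) * ν₀) = (k : ℂ) * ν₀ := by simp
  rcases int_trichotomy n with rfl | ⟨l, rfl⟩ | ⟨l, rfl⟩
  · rw [vertexZero, vertexZero, vertexZero, expOp_comm _ (by simp), expOp_comm _ le_rfl, ip_c,
      neg_neg, Rpow_c_zero, ip_add_right, ip_smul_right, commCoeff, if_pos rfl]
    ring
  · have hl : (l : ℤ) ≠ 0 := by exact_mod_cast l.ne_zero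
    rw [vertexZero, vertexZero, vertexZero, expOp_comm_neg, expOp_comm _ (by simp), Rpow_c hl,
      ip_add_left, ip_smul_left, ip_c, neg_neg, commCoeff, if_neg hl, hconj]
    ring
  · have hl : -(l : ℤ) ≠ 0 := by simp
    rw [vertexZero, vertexZero, vertexZero, expOp_comm_neg, expOp_comm _ (by simp), map_add,
      Rpow_c hl, ip_add_right, map_smul, ip_smul_right, ip_c, neg_neg, commCoeff, if_neg hl]
    ring

/-- By the case `n = 0` of `vertexZero_c`, the matrix element times `a.1 - b.1 - k` is zero. -/
theorem vertexZero_boson_eq_zero (ν₀ : ℝ) (k : ℤ) {a b : Label} (hab : a.1 ≠ b.1 + k) :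
    vertexZero ν₀ k (boson a) (boson b) = 0 := by
  have h := vertexZero_c ν₀ k 0 (boson a) (boson b)
  rw [neg_zero, c_zero_boson, c_zero_boson, commCoeff, if_pos rfl] at h
  simp only [vertexZero, map_smul, ip_smul_left, ip_smul_right, map_intCast] at h ⊢
  have h1 : ((a.1 : ℂ) - b.1 - k) ≠ 0 := by
    intro h0
    apply hab
    have : (a.1 : ℂ) = ((b.1 + k : ℤ) : ℂ) := by push_cast; linear_combination h0
    exact_mod_cast this
  refine (mul_eq_zero.1 ?_).resolve_left h1
  linear_combination h

/-- The matrix elements are monomials in `e^{ix}` with exponent the difference of degrees, so the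
contour integral either returns the coefficient or zero. The contour height `1` is an arbitrary
choice. -/
theorem phiHat_boson_apply (ν₀ : ℝ) (k m : ℤ) (a b : Label) :
    phiHat ν₀ k m (boson b) a =
      if (deg a.2 : ℤ) = deg b.2 + m then vertexZero ν₀ k (boson a) (boson b) else 0 := by
  have h := (existsUnique_fourierMode ν₀ k m).choose_spec.1 1 one_pos a b
  rw [phiHat, h]
  have h1 : ∀ t : ℝ, periodicVertexForm ν₀ k (t - (1 : ℝ) * Complex.I) (boson a) (boson b) *
        Complex.exp (Complex.I * m * (t - (1 : ℝ) * Complex.I)) =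
      vertexZero ν₀ k (boson a) (boson b) *
        Complex.exp (Complex.I * ((deg b.2 : ℤ) - deg a.2 + m : ℤ) *
          (t - (1 : ℝ) * Complex.I)) := by
    intro t
    rw [periodicVertexForm_boson, periodicVertexForm_eq, map_zero, ← vertexZero,
      mul_comm (Complex.exp _) (vertexZero _ _ _ _), mul_assoc, ← Complex.exp_add]
    congr 2
    push_cast
    ring
  simp only [h1]
  rw [intervalIntegral.integral_const_mul, mul_left_comm, integral_mode]
  have : ((deg b.2 : ℤ) - deg a.2 + m = 0) ↔ ((deg a.2 : ℤ) = deg b.2 + m) := by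
    constructor <;> intro h <;> linarith
  simp [this]

theorem phiHat_mem_graded (ν₀ : ℝ) (k m : ℤ) {q d : ℤ} {v : Db} (hv : v ∈ graded q d) :
    phiHat ν₀ k m v ∈ graded (q + k) (d + m) := by
  refine map_mem_supported (fun b hb => ?_) hv
  intro a ha
  rw [Finset.mem_coe, Finsupp.mem_support_iff, phiHat_boson_apply] at ha
  rw [Set.mem_ofPred_eq, ← hb.1, ← hb.2]
  constructor
  · by_contra h
    rw [vertexZero_boson_eq_zero ν₀ k h] at ha
    simp at ha
  · by_contra h
    rw [if_neg h] at ha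
    exact ha rfl

theorem ip_phiHat (ν₀ : ℝ) (k m : ℤ) {q d q' e : ℤ} {v w : Db} (hv : v ∈ graded q d)
    (hw : w ∈ graded q' e) :
    ip v (phiHat ν₀ k m w) = if d = e + m then vertexZero ν₀ k v w else 0 := by
  rw [graded, Finsupp.supported_eq_span_single] at hv
  induction hv using Submodule.span_induction with
  | mem x hx =>
    obtain ⟨a, ha, rfl⟩ := hx
    change ip (boson a) _ = if _ then vertexZero ν₀ k (boson a) w else 0
    rw [graded, Finsupp.supported_eq_span_single] at hw
    induction hw using Submodule.span_induction with
    | mem y hy =>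
      obtain ⟨b, hb, rfl⟩ := hy
      change ip (boson a) (phiHat ν₀ k m (boson b)) =
        if _ then vertexZero ν₀ k (boson a) (boson b) else 0
      rw [ip_boson, phiHat_boson_apply, ha.2, hb.2]
    | zero => simp [vertexZero, ip]
    | add x y _ _ hx hy =>
      rw [map_add, ip_add_right, hx, hy]
      simp only [vertexZero, map_add, ip_add_right]
      split_ifs <;> simp
    | smul z x _ hx =>
      rw [map_smul, ip_smul_right, hx]
      simp only [vertexZero, map_smul, ip_smul_right]
      split_ifs <;> simp
  | zero => simp [vertexZero, ip]
  | add x y _ _ hx hy =>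
    rw [ip_add_left, hx, hy]
    simp only [vertexZero, map_add, ip_add_left]
    split_ifs <;> simp
  | smul z x _ hx =>
    rw [ip_smul_left, hx]
    simp only [vertexZero, map_smul, ip_smul_left]
    split_ifs <;> simp

/-- Compare matrix elements: `vertexZero_c` supplies the scalar, and moving `c n` across shifts the
degree selection, hence the mode number, by `n`. -/
theorem c_phiHat (ν₀ : ℝ) (k n m : ℤ) :
    c n * phiHat ν₀ k m = phiHat ν₀ k m * c n + commCoeff ν₀ k n • phiHat ν₀ k (m - n) := by
  apply end_ext
  intro b
  ext a
  have ha := boson_mem_graded a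
  have hb := boson_mem_graded b
  have h1 := ip_c (-n) (boson a) (phiHat ν₀ k m (boson b))
  rw [neg_neg, ip_boson, ip_phiHat ν₀ k m (c_mem_graded (-n) ha) hb] at h1
  have h2 := ip_phiHat ν₀ k m ha (c_mem_graded n hb)
  have h3 := ip_phiHat ν₀ k (m - n) ha hb
  rw [ip_boson] at h2 h3
  have h4 := vertexZero_c ν₀ k n (boson a) (boson b)
  rw [LinearMap.add_apply, LinearMap.smul_apply, Finsupp.add_apply, Finsupp.smul_apply,
    Module.End.mul_apply, Module.End.mul_apply, ← h1, h2, h3, smul_eq_mul]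
  by_cases h : (deg a.2 : ℤ) = deg b.2 + m - n
  · rw [if_pos (by omega), if_pos (by omega), if_pos (by omega)]
    linear_combination h4
  · rw [if_neg (by omega), if_neg (by omega), if_neg (by omega)]
    simp

/-! ### Rearranging double sums over positive momenta -/

theorem sum_box {V : Type} [AddCommMonoid V] (P : ℕ) (f : ℕ → V) :
    ∑ k ∈ box P, f k = ∑ i ∈ Finset.Icc 1 P, f i := by
  rw [box, Finset.sum_map]
  simp only [Function.Embedding.coeFn_mk, Nat.succPNat_coe, Nat.succ_eq_add_one]
  rw [← Finset.sum_image (g := fun i => i + 1) (f := f) (by intro a _ b _ h; simpa using h)]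
  congr 1
  ext i
  simp only [Finset.mem_image, Finset.mem_range, Finset.mem_Icc]
  constructor
  · rintro ⟨a, ha, rfl⟩
    omega
  · rintro ⟨h1, h2⟩
    exact ⟨i - 1, by omega, by omega⟩

theorem sum_Icc_shift {V : Type} [AddCommMonoid V] (P a : ℕ) (g : ℕ → V)
    (hg : ∀ n, P < n → g n = 0) :
    ∑ b ∈ Finset.Icc 1 P, g (a + b) = ∑ n ∈ Finset.Icc 1 P, if a < n then g n else 0 := by
  rw [← Finset.sum_filter, ← Finset.sum_image (g := fun b => a + b) (f := g)
    (by intro x _ y _ h; simpa using h)]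
  refine (Finset.sum_subset ?_ ?_).symm
  · intro n hn
    simp only [Finset.mem_filter, Finset.mem_Icc, Finset.mem_image] at hn ⊢
    exact ⟨n - a, by omega, by omega⟩
  · intro n hn hn'
    simp only [Finset.mem_filter, Finset.mem_Icc, Finset.mem_image] at hn hn'
    obtain ⟨b, hb, rfl⟩ := hn
    exact hg _ (by omega)

/-- The pairs `(a, a + b)` and `(a + b, a)` exhaust the off-diagonal pairs, each once; those beyond
the cutoff contribute nothing. -/
theorem sum_Icc_pairs {V : Type} [AddCommGroup V] (P : ℕ) (f : ℕ → ℕ → V)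
    (hf : ∀ i j, P < i ∨ P < j → f i j = 0) :
    ∑ a ∈ Finset.Icc 1 P, ∑ b ∈ Finset.Icc 1 P, (f a (a + b) + f (a + b) a) =
      ∑ i ∈ Finset.Icc 1 P, ∑ j ∈ Finset.Icc 1 P, f i j - ∑ i ∈ Finset.Icc 1 P, f i i := by
  have h1 : ∀ a, ∑ b ∈ Finset.Icc 1 P, f a (a + b) =
      ∑ n ∈ Finset.Icc 1 P, if a < n then f a n else 0 := fun a =>
    sum_Icc_shift P a (f a) fun n hn => hf _ _ (Or.inr hn)
  have h2 : ∀ a, ∑ b ∈ Finset.Icc 1 P, f (a + b) a =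
      ∑ n ∈ Finset.Icc 1 P, if a < n then f n a else 0 := fun a =>
    sum_Icc_shift P a (fun n => f n a) fun n hn => hf _ _ (Or.inl hn)
  have h3 : ∀ i ∈ Finset.Icc 1 P, f i i = ∑ j ∈ Finset.Icc 1 P, if i = j then f i j else 0 := by
    intro i hi
    rw [Finset.sum_ite_eq, if_pos hi]
  simp only [Finset.sum_add_distrib, h1, h2]
  rw [Finset.sum_congr rfl h3, eq_sub_iff_add_eq,
    Finset.sum_comm (f := fun a n => if a < n then f n a else 0), ← Finset.sum_add_distrib,
    ← Finset.sum_add_distrib]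
  refine Finset.sum_congr rfl fun i _ => ?_
  rw [← Finset.sum_add_distrib, ← Finset.sum_add_distrib]
  refine Finset.sum_congr rfl fun j _ => ?_
  rcases lt_trichotomy i j with h | h | h
  · simp [h, h.ne, h.not_gt]
  · simp [h]
  · simp [h, h.ne', h.not_gt]

/-- A positive integer `n` is a sum of two positive integers in `n - 1` ways. -/
theorem sum_Icc_add {V : Type} [AddCommGroup V] [Module ℂ V] (P : ℕ) (g : ℕ → V)
    (hg : ∀ n, P < n → g n = 0) :
    ∑ a ∈ Finset.Icc 1 P, ∑ b ∈ Finset.Icc 1 P, g (a + b) =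
      ∑ n ∈ Finset.Icc 1 P, (n : ℂ) • g n - ∑ n ∈ Finset.Icc 1 P, g n := by
  simp only [sum_Icc_shift P _ g hg]
  rw [Finset.sum_comm, ← Finset.sum_sub_distrib]
  refine Finset.sum_congr rfl fun n hn => ?_
  rw [← Finset.sum_filter, Finset.sum_const]
  have : (Finset.Icc 1 P).filter (fun a => a < n) = Finset.Icc 1 (n - 1) := by
    ext a
    simp only [Finset.mem_Icc, Finset.mem_filter] at hn ⊢
    omega
  rw [this, Nat.card_Icc]
  simp only [Finset.mem_Icc] at hn
  have h1 : n - 1 + 1 - 1 = n - 1 := by omega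
  rw [h1, ← Nat.cast_smul_eq_nsmul ℂ, Nat.cast_sub hn.1]
  module

/-! ### The Hamiltonians on states of given charge and degree -/

theorem sum_number_apply {q d : ℤ} {v : Db} (hv : v ∈ graded q d) {P : ℕ} (hP : d ≤ P) :
    ∑ n ∈ Finset.Icc 1 P, c (-(n : ℤ)) (c n v) = (d : ℂ) • v := by
  rw [← sum_box P fun n => c (-(n : ℤ)) (c n v)]
  have h := eqOn_supported (S := ∑ n ∈ box P, c (-(n : ℤ)) * c n) (T := (d : ℂ) • 1)
    (fun a ha => ?_) hv
  · simpa [LinearMap.sum_apply] using h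
  have h1 : ∀ n : ℕ+, (c (-(n : ℤ)) * c n) (boson a) = ((n : ℂ) * a.2 n) • boson a := by
    intro n
    rw [Module.End.mul_apply, c_pos, c_neg, lower, ofBoson_boson, map_smul, raise, ofBoson_boson,
      smul_smul]
    by_cases h0 : a.2 n = 0
    · simp [h0]
    · have hle : Finsupp.single n 1 ≤ a.2 := by
        rw [Finsupp.single_le_iff]; omega
      have h2 : ((a.2 n - 1 : ℕ) : ℝ) + 1 = a.2 n := by
        have : 1 ≤ a.2 n := by omega
        push_cast [this]; ring
      rw [tsub_add_cancel_of_le hle, Finsupp.tsub_apply, Finsupp.single_eq_same, h2,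
        ← Complex.ofReal_mul, Real.mul_self_sqrt (by positivity)]
      push_cast
      rfl
  rw [LinearMap.sum_apply, Finset.sum_congr rfl fun n _ => h1 n, ← Finset.sum_smul,
    LinearMap.smul_apply, Module.End.one_apply, ← ha.2, deg, Finsupp.sum]
  congr 1
  push_cast
  refine (Finset.sum_subset ?_ ?_).symm
  · intro n hn
    rw [mem_box]
    have h2 : (n : ℕ) * a.2 n ≤ deg a.2 := by
      rw [deg, Finsupp.sum]
      exact Finset.single_le_sum (f := fun k : ℕ+ => (k : ℕ) * a.2 k) (fun _ _ => Nat.zero_le _) hn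
    have h3 := Nat.le_mul_of_pos_right (n : ℕ) (Nat.pos_of_ne_zero (Finsupp.mem_support_iff.1 hn))
    have := ha.2
    omega
  · intro n _ hn
    simp [Finsupp.notMem_support_iff.1 hn]

theorem chargeOp_apply (ν₀ : ℝ) {q d : ℤ} {v : Db} (hv : v ∈ graded q d) :
    chargeOp ν₀ v = ((ν₀ : ℂ) * q) • v := by
  rw [chargeOp, LinearMap.smul_apply, c_zero_apply hv, smul_smul]

theorem H1_apply (ν₀ ν : ℝ) {q d : ℤ} {v : Db} (hv : v ∈ graded q d) :
    H1 ν₀ ν v = ((ν : ℂ)⁻¹ * (ν₀ * q)) • v := by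
  rw [H1, LinearMap.smul_apply, chargeOp_apply ν₀ hv, smul_smul]

theorem number_boson_eq_zero {q d : ℤ} {P : ℕ} (hP : d ≤ P) (a : Label)
    (ha : a ∈ {a : Label | a.1 = q ∧ (deg a.2 : ℤ) = d}) (n : ℕ+) (hn : n ∉ box P) :
    c n (boson a) = 0 := by
  rw [mem_box] at hn
  exact c_eq_zero (d := d) (by omega) (boson_mem_filt ha.2.le)

theorem H2_apply (ν₀ : ℝ) {q d : ℤ} {v : Db} (hv : v ∈ graded q d) :
    H2 ν₀ v = (1 / 2 * ((ν₀ : ℂ) * q) ^ 2 + d) • v := by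
  have hP : d ≤ (d.toNat : ℤ) := by omega
  rw [H2, LinearMap.add_apply, LinearMap.smul_apply, pow_two, Module.End.mul_apply,
    chargeOp_apply ν₀ hv, map_smul, chargeOp_apply ν₀ hv, locSum_apply (F := box d.toNat) _ hv,
    sum_box d.toNat (fun n => (c (-(n : ℤ)) * c n) v)]
  · simp only [Module.End.mul_apply]
    rw [sum_number_apply hv hP]
    module
  · intro a ha n hn
    rw [Module.End.mul_apply, number_boson_eq_zero hP a ha n hn, map_zero]

/-- The six ways to order the momenta `-a`, `-b`, `a + b` or `a`, `b`, `-(a + b)` such that the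
order of the pair `(a, b)` is kept. -/
def triple (i : Fin 6) (a b : ℤ) : ℤ × ℤ × ℤ :=
  match i with
  | 0 => (-a, -b, a + b)
  | 1 => (-a, a + b, -b)
  | 2 => (a + b, -a, -b)
  | 3 => (a, b, -(a + b))
  | 4 => (a, -(a + b), b)
  | 5 => (-(a + b), a, b)

/-- Non-zero momenta that sum to zero. -/
abbrev ZeroSum : Type :=
  {p : ℤ × ℤ × ℤ // p.1 ≠ 0 ∧ p.2.1 ≠ 0 ∧ p.2.2 ≠ 0 ∧ p.1 + p.2.1 + p.2.2 = 0}

theorem triple_mem (i : Fin 6) (a b : ℕ+) :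
    (triple i a b).1 ≠ 0 ∧ (triple i a b).2.1 ≠ 0 ∧ (triple i a b).2.2 ≠ 0 ∧
      (triple i a b).1 + (triple i a b).2.1 + (triple i a b).2.2 = 0 := by
  have ha := a.pos
  have hb := b.pos
  fin_cases i <;> simp only [triple] <;> omega

/-- Among three non-zero integers with sum zero, one has the sign opposite to the other two. Its
sign and its place are recorded in `Fin 6`, the other two up to sign in `a` and `b`. -/
theorem triple_bijective : Function.Bijective fun x : Fin 6 × ℕ+ × ℕ+ =>
    (⟨triple x.1 x.2.1 x.2.2, triple_mem x.1 x.2.1 x.2.2⟩ : ZeroSum) := by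
  constructor
  · rintro ⟨i, a, b⟩ ⟨j, a', b'⟩ h
    have h := congrArg Subtype.val h
    have ha := a.pos
    have hb := b.pos
    have ha' := a'.pos
    have hb' := b'.pos
    simp only [Prod.mk.injEq, ← PNat.coe_inj, ← @Nat.cast_inj ℤ]
    fin_cases i <;> fin_cases j <;> simp [triple] at h ⊢ <;>
      first | omega | tauto
  · rintro ⟨⟨x, y, z⟩, hx, hy, hz, h⟩
    simp only at hx hy hz h
    have pos : ∀ w : ℤ, 0 < w → ∃ k : ℕ+, (k : ℤ) = w := fun w hw =>
      ⟨⟨w.toNat, by omega⟩, by simp only [PNat.mk_coe]; omega⟩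
    have key : ∀ i : Fin 6, ∀ a b : ℤ, 0 < a → 0 < b → triple i a b = (x, y, z) →
        ∃ p : Fin 6 × ℕ+ × ℕ+, (⟨triple p.1 p.2.1 p.2.2, triple_mem p.1 p.2.1 p.2.2⟩ : ZeroSum) =
          ⟨(x, y, z), hx, hy, hz, h⟩ := by
      intro i a b ha hb hi
      obtain ⟨a, rfl⟩ := pos a ha
      obtain ⟨b, rfl⟩ := pos b hb
      exact ⟨(i, a, b), Subtype.ext hi⟩
    rcases lt_or_gt_of_ne hx with hx' | hx' <;> rcases lt_or_gt_of_ne hy with hy' | hy' <;>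
      rcases lt_or_gt_of_ne hz with hz' | hz'
    · omega
    · refine key 0 (-x) (-y) (by omega) (by omega) ?_
      simp only [triple, Prod.mk.injEq]; omega
    · refine key 1 (-x) (-z) (by omega) (by omega) ?_
      simp only [triple, Prod.mk.injEq]; omega
    · exact key 5 y z hy' hz' (Prod.ext (by change -(y + z) = x; omega) rfl)
    · refine key 2 (-y) (-z) (by omega) (by omega) ?_
      simp only [triple, Prod.mk.injEq]; omega
    · exact key 4 x z hx' hz' (Prod.ext rfl (Prod.ext (by change -(x + z) = y; omega) rfl))
    · exact key 3 x y hx' hy' (Prod.ext rfl (Prod.ext rfl (by change -(x + y) = z; omega)))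
    · omega

theorem normalOrder_triple (i : Fin 6) (a b : ℕ+) :
    normalOrder [(triple i a b).1, (triple i a b).2.1, (triple i a b).2.2] =
      if i < 3 then c (-(a : ℤ)) * (c (-(b : ℤ)) * c ((a : ℤ) + b))
      else c (-((a : ℤ) + b)) * (c b * c a) := by
  have ha : (0 : ℤ) < a := by exact_mod_cast a.pos
  have hb : (0 : ℤ) < b := by exact_mod_cast b.pos
  have hab : (0 : ℤ) < a + b := by omega
  have ha' : ¬ (0 : ℤ) < -a := by omega
  have hb' : ¬ (0 : ℤ) < -b := by omega
  have hab' : ¬ (0 : ℤ) < -(a + b) := by omega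
  have ha'' : -(a : ℤ) < 0 := by omega
  have hb'' : -(b : ℤ) < 0 := by omega
  have hab'' : -((a : ℤ) + b) < 0 := by omega
  fin_cases i <;>
    simp only [triple, normalOrder, ha, hb, hab, ha', hb', hab', ha'', hb'', hab'', if_true,
      if_false, mul_one, one_mul, mul_assoc] <;> rfl

/-- The cubic part of `H^{ν,3}`, with the momenta cut off at `P`. -/
noncomputable def cubic (P : ℕ) : Module.End ℂ Db :=
  ∑ a ∈ Finset.Icc 1 P, ∑ b ∈ Finset.Icc 1 P,
    (c (-(a : ℤ)) * (c (-(b : ℤ)) * c ((a : ℤ) + b)) + c (-((a : ℤ) + b)) * (c b * c a))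

/-- Normal ordering forgets the place of the exceptional momentum, so each product occurs three
times. This cancels the `1 / 3` in `H3`. -/
theorem locSum_normalOrder_apply {q d : ℤ} {v : Db} (hv : v ∈ graded q d) {P : ℕ} (hP : d ≤ P) :
    locSum (fun p : ZeroSum => normalOrder [p.1.1, p.1.2.1, p.1.2.2]) v = (3 : ℂ) • cubic P v := by
  have h1 : locSum (fun p : ZeroSum => normalOrder [p.1.1, p.1.2.1, p.1.2.2]) =
      locSum fun x : Fin 6 × ℕ+ × ℕ+ => normalOrder [(triple x.1 x.2.1 x.2.2).1,
        (triple x.1 x.2.1 x.2.2).2.1, (triple x.1 x.2.1 x.2.2).2.2] := by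
    rw [locSum, locSum]
    congr 1
    ext1 a
    exact (finsum_comp_equiv (f := fun p : ZeroSum =>
      normalOrder [p.1.1, p.1.2.1, p.1.2.2] (boson a)) (Equiv.ofBijective _ triple_bijective)).symm
  rw [h1, locSum_apply (F := Finset.univ ×ˢ box P ×ˢ box P) _ hv]
  · rw [Finset.sum_product, cubic]
    simp only [normalOrder_triple, Fin.sum_univ_six, Finset.sum_product]
    rw [← LinearMap.smul_apply]
    simp only [← LinearMap.sum_apply]
    rw [← LinearMap.add_apply, ← LinearMap.add_apply, ← LinearMap.add_apply, ← LinearMap.add_apply,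
      ← LinearMap.add_apply]
    congr 1
    have h2 : ∀ (f : ℕ → ℕ → Module.End ℂ Db), ∑ a ∈ box P, ∑ b ∈ box P, f a b =
        ∑ a ∈ Finset.Icc 1 P, ∑ b ∈ Finset.Icc 1 P, f a b := by
      intro f
      rw [← sum_box P]
      exact Finset.sum_congr rfl fun a _ => sum_box P (f a)
    rw [← h2 fun a b => _]
    simp only [Finset.sum_add_distrib]
    simp only [show (0 : Fin 6) < 3 by decide, show (1 : Fin 6) < 3 by decide,
      show (2 : Fin 6) < 3 by decide, show ¬ (3 : Fin 6) < 3 by decide,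
      show ¬ (4 : Fin 6) < 3 by decide, show ¬ (5 : Fin 6) < 3 by decide, if_true, if_false]
    module
  · rintro a ha ⟨i, k, l⟩ hx
    have hx : P < (k : ℕ) + l := by
      by_contra h
      have hk := k.pos
      have hl := l.pos
      exact hx (by simp only [Finset.mem_product, Finset.mem_univ, true_and, mem_box]; omega)
    have hk := k.pos
    have hl := l.pos
    have ha' : boson a ∈ filt d := boson_mem_filt ha.2.le
    rw [normalOrder_triple]
    dsimp only
    split_ifs
    · rw [Module.End.mul_apply, Module.End.mul_apply, c_eq_zero (by omega) ha', map_zero, map_zero]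
    · rw [Module.End.mul_apply, Module.End.mul_apply,
        c_eq_zero (by omega) (c_mem_filt k ha'), map_zero]

/-- The cutoff is any bound on the degree, so that a state and its image under a vertex mode can
share one. -/
theorem H3_apply (ν₀ ν : ℝ) {q d : ℤ} {v : Db} (hv : v ∈ graded q d) {P : ℕ} (hP : d ≤ P) :
    H3 ν₀ ν v = (ν : ℂ) • cubic P v +
      (1 - (ν : ℂ) ^ 2) • ∑ n ∈ Finset.Icc 1 P, (n : ℂ) • c (-(n : ℤ)) (c n v) +
      (2 * ν * (ν₀ * q) * d + ν / 3 * (ν₀ * q) ^ 3 - ν ^ 3 / 12 * (ν₀ * q) : ℂ) • v := by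
  rw [H3, LinearMap.sub_apply, LinearMap.add_apply, LinearMap.add_apply, LinearMap.smul_apply,
    LinearMap.smul_apply, LinearMap.smul_apply, locSum_normalOrder_apply hv hP,
    locSum_apply (F := box P) _ hv, chargeOp_apply ν₀ hv]
  · have h3 : (chargeOp ν₀ ^ 3) v = ((ν₀ : ℂ) * q) ^ 3 • v := by
      simp only [pow_succ, pow_zero, one_mul, Module.End.mul_apply, chargeOp_apply ν₀ hv, map_smul,
        smul_smul]
      ring_nf
    have h4 : ∀ n : ℕ+, (((((1 - (ν : ℂ) ^ 2) * (n : ℂ)) • (1 : Module.End ℂ Db) +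
        (2 * (ν : ℂ)) • chargeOp ν₀) * (c (-(n : ℤ)) * c n)) v) =
        (1 - (ν : ℂ) ^ 2) • ((n : ℕ) : ℂ) • c (-((n : ℕ) : ℤ)) (c ((n : ℕ) : ℤ) v) +
          (2 * ν * (ν₀ * q) : ℂ) • c (-((n : ℕ) : ℤ)) (c ((n : ℕ) : ℤ) v) := by
      intro n
      rw [Module.End.mul_apply, Module.End.mul_apply, LinearMap.add_apply, LinearMap.smul_apply,
        LinearMap.smul_apply, chargeOp_apply ν₀ (c_mem_graded _ (c_mem_graded _ hv)), smul_smul,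
        smul_smul]
      rfl
    rw [h3, Finset.sum_congr rfl fun n _ => h4 n,
      sum_box P fun n => (1 - (ν : ℂ) ^ 2) • (n : ℂ) • c (-(n : ℤ)) (c (n : ℤ) v) +
          (2 * ν * (ν₀ * q) : ℂ) • c (-(n : ℤ)) (c (n : ℤ) v), Finset.sum_add_distrib,
      ← Finset.smul_sum, ← Finset.smul_sum, sum_number_apply hv hP]
    module
  · intro a ha n hn
    rw [Module.End.mul_apply, Module.End.mul_apply, number_boson_eq_zero hP a ha n hn, map_zero,
      map_zero]

/-! ### The commutator of `H^{ν,3}` with the vertex operators -/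

theorem c_phiHat_apply (ν₀ : ℝ) (k : ℤ) {n : ℤ} (hn : n ≠ 0) (m : ℤ) (v : Db) :
    c n (phiHat ν₀ k m v) =
      phiHat ν₀ k m (c n v) + ((k : ℂ) * ν₀) • phiHat ν₀ k (m - n) v := by
  have := LinearMap.congr_fun (c_phiHat ν₀ k n m) v
  rwa [commCoeff, if_neg hn] at this

theorem phiHat_number_commutator (ν₀ : ℝ) (k m : ℤ) {n : ℕ} (hn : 1 ≤ n) (v : Db) :
    c (-(n : ℤ)) (c n (phiHat ν₀ k m v)) = phiHat ν₀ k m (c (-(n : ℤ)) (c n v)) +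
      ((k : ℂ) * ν₀) • (c (-(n : ℤ)) (phiHat ν₀ k (m - n) v) + phiHat ν₀ k (m + n) (c n v)) := by
  rw [c_phiHat_apply ν₀ k (by omega), map_add, map_smul, c_phiHat_apply ν₀ k (by omega),
    sub_neg_eq_add]
  module

/-- The Fourier modes of the derivative of a vertex operator. -/
theorem mode_smul_phiHat (ν₀ : ℝ) (k m : ℤ) {q d : ℤ} {v : Db} (hv : v ∈ graded q d) {P : ℕ}
    (hP : d ≤ P) (hP' : d + m ≤ P) :
    (m : ℂ) • phiHat ν₀ k m v = ((k : ℂ) * ν₀) • ∑ n ∈ Finset.Icc 1 P,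
      (c (-(n : ℤ)) (phiHat ν₀ k (m - n) v) + phiHat ν₀ k (m + n) (c n v)) := by
  -- The scalar `m` is the degree of the image minus that of `v`; both are measured by `∑ c₋ₙ cₙ`.
  have h1 := sum_number_apply (phiHat_mem_graded ν₀ k m hv) hP'
  have h2 := congrArg (phiHat ν₀ k m) (sum_number_apply hv hP)
  rw [Finset.sum_congr rfl fun n hn =>
    phiHat_number_commutator ν₀ k m (Finset.mem_Icc.1 hn).1 v, Finset.sum_add_distrib,
    ← Finset.smul_sum, ← map_sum, h2, map_smul] at h1
  push_cast at h1
  linear_combination (norm := module) -h1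

section Commutator

variable (ν₀ : ℝ) (k m : ℤ) (v : Db)

theorem two_creation_commutator {a b : ℕ} (ha : 1 ≤ a) (hb : 1 ≤ b) :
    c (-(a : ℤ)) (c (-(b : ℤ)) (c ((a : ℤ) + b) (phiHat ν₀ k m v))) =
      phiHat ν₀ k m (c (-(a : ℤ)) (c (-(b : ℤ)) (c ((a : ℤ) + b) v))) +
      ((k : ℂ) * ν₀) • (c (-(a : ℤ)) (c (-(b : ℤ)) (phiHat ν₀ k (m - a - b) v)) +
        c (-(a : ℤ)) (phiHat ν₀ k (m - a + (a + b : ℕ)) (c (a + b : ℕ) v)) +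
        c (-(b : ℤ)) (phiHat ν₀ k (m - b + (a + b : ℕ)) (c (a + b : ℕ) v))) -
      ((k : ℂ) * ν₀) ^ 2 • phiHat ν₀ k (m + (a + b : ℕ)) (c (a + b : ℕ) v) := by
  have e1 : m - (a : ℤ) + (a + b : ℕ) = m - -(b : ℤ) := by push_cast; ring
  have e2 : m - (b : ℤ) + (a + b : ℕ) = m - -(a : ℤ) := by push_cast; ring
  have e3 : m + ((a + b : ℕ) : ℤ) = m - -(a : ℤ) - -(b : ℤ) := by push_cast; ring
  have e4 : m - (a : ℤ) - b = m - (a + b) := by ring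
  rw [e1, e2, e3, e4, Nat.cast_add, c_phiHat_apply ν₀ k (by omega : (a : ℤ) + b ≠ 0)]
  simp only [map_add, map_smul, c_phiHat_apply ν₀ k (by omega : -(a : ℤ) ≠ 0),
    c_phiHat_apply ν₀ k (by omega : -(b : ℤ) ≠ 0)]
  module

theorem two_annihilation_commutator {a b : ℕ} (ha : 1 ≤ a) (hb : 1 ≤ b) :
    c (-((a : ℤ) + b)) (c b (c a (phiHat ν₀ k m v))) =
      phiHat ν₀ k m (c (-((a : ℤ) + b)) (c b (c a v))) +
      ((k : ℂ) * ν₀) • (phiHat ν₀ k (m + a + b) (c b (c a v)) +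
        c (-((a + b : ℕ) : ℤ)) (phiHat ν₀ k (m - (a + b : ℕ) + a) (c a v)) +
        c (-((a + b : ℕ) : ℤ)) (phiHat ν₀ k (m - (a + b : ℕ) + b) (c b v))) +
      ((k : ℂ) * ν₀) ^ 2 • c (-((a + b : ℕ) : ℤ)) (phiHat ν₀ k (m - (a + b : ℕ)) v) := by
  have e1 : m - ((a + b : ℕ) : ℤ) + a = m - b := by push_cast; ring
  have e2 : m - ((a + b : ℕ) : ℤ) + b = m - a := by push_cast; ring
  have e3 : m - ((a + b : ℕ) : ℤ) = m - a - b := by push_cast; ring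
  have e4 : m + (a : ℤ) + b = m - -(a + b) := by ring
  rw [e1, e2, e3, e4, Nat.cast_add]
  simp only [map_add, map_smul, c_phiHat_apply ν₀ k (by omega : (a : ℤ) ≠ 0),
    c_phiHat_apply ν₀ k (by omega : (b : ℤ) ≠ 0),
    c_phiHat_apply ν₀ k (by omega : -((a : ℤ) + b) ≠ 0)]
  module

end Commutator

/-- The modes of a vertex operator between one creation and one annihilation operator vanish for
large momenta. -/
theorem create_phiHat_annihilate_eq_zero (ν₀ : ℝ) (k m : ℤ) {q d : ℤ} {v : Db}
    (hv : v ∈ graded q d) {P : ℕ} (hP : d ≤ P) (hP' : d + m ≤ P) (i j : ℕ) (h : P < i ∨ P < j) :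
    c (-(j : ℤ)) (phiHat ν₀ k (m - j + i) (c i v)) = 0 := by
  rcases h with h | h
  · rw [eq_zero_of_mem_graded (by omega) (c_mem_graded i hv), map_zero, map_zero]
  · rw [eq_zero_of_mem_graded (by omega) (phiHat_mem_graded ν₀ k (m - j + i) (c_mem_graded i hv)),
      map_zero]

/-- The mixed terms `c₋ⱼ phiHat cᵢ` come twice from all pairs `i ≠ j`. Completing them by the
diagonal produces the full double sum of the second derivative, at the price of the subtracted terms
with `d` and `phiHat (m + n) cₙ`. The terms of second order in `k ν₀` depend on `a + b` only and are
counted by `sum_Icc_add`. -/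
theorem cubic_commutator (ν₀ : ℝ) (k m : ℤ) {q d : ℤ} {v : Db} (hv : v ∈ graded q d) {P : ℕ}
    (hP : d ≤ P) (hP' : d + m ≤ P) :
    cubic P (phiHat ν₀ k m v) = phiHat ν₀ k m (cubic P v) +
      ((k : ℂ) * ν₀) • (∑ i ∈ Finset.Icc 1 P, ∑ j ∈ Finset.Icc 1 P,
          c (-(i : ℤ)) (c (-(j : ℤ)) (phiHat ν₀ k (m - i - j) v)) +
        ∑ i ∈ Finset.Icc 1 P, ∑ j ∈ Finset.Icc 1 P, phiHat ν₀ k (m + i + j) (c j (c i v)) +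
        (2 : ℂ) • ∑ i ∈ Finset.Icc 1 P, ∑ j ∈ Finset.Icc 1 P,
          c (-(j : ℤ)) (phiHat ν₀ k (m - j + i) (c i v)) -
        (2 : ℂ) • ((d : ℂ) • phiHat ν₀ k m v +
          ((k : ℂ) * ν₀) • ∑ n ∈ Finset.Icc 1 P, phiHat ν₀ k (m + n) (c n v))) +
      ((k : ℂ) * ν₀) ^ 2 • (∑ n ∈ Finset.Icc 1 P, (n : ℂ) • c (-(n : ℤ)) (phiHat ν₀ k (m - n) v) -
        ∑ n ∈ Finset.Icc 1 P, c (-(n : ℤ)) (phiHat ν₀ k (m - n) v)) -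
      ((k : ℂ) * ν₀) ^ 2 • (∑ n ∈ Finset.Icc 1 P, (n : ℂ) • phiHat ν₀ k (m + n) (c n v) -
        ∑ n ∈ Finset.Icc 1 P, phiHat ν₀ k (m + n) (c n v)) := by
  set X : ℕ → ℕ → Db := fun i j => c (-(j : ℤ)) (phiHat ν₀ k (m - j + i) (c i v)) with hX
  have hX0 : ∀ i j, P < i ∨ P < j → X i j = 0 :=
    create_phiHat_annihilate_eq_zero ν₀ k m hv hP hP'
  have hXs := sum_Icc_pairs P X hX0
  have hXs' := sum_Icc_pairs P (fun i j => X j i) fun i j h => hX0 j i h.symm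
  have hdiag : ∑ i ∈ Finset.Icc 1 P, X i i = (d : ℂ) • phiHat ν₀ k m v +
      ((k : ℂ) * ν₀) • ∑ n ∈ Finset.Icc 1 P, phiHat ν₀ k (m + n) (c n v) := by
    rw [← map_smul, ← sum_number_apply hv hP, map_sum, Finset.smul_sum, ← Finset.sum_add_distrib]
    refine Finset.sum_congr rfl fun i hi => ?_
    have hi := (Finset.mem_Icc.1 hi).1
    rw [hX]
    dsimp only
    rw [sub_add_cancel, c_phiHat_apply ν₀ k (by omega), sub_neg_eq_add]
  have hA := sum_Icc_add P (fun n => phiHat ν₀ k (m + n) (c n v)) fun n hn => by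
    rw [eq_zero_of_mem_graded (by omega) (c_mem_graded n hv), map_zero]
  have hC := sum_Icc_add P (fun n => c (-(n : ℤ)) (phiHat ν₀ k (m - n) v)) fun n hn => by
    rw [eq_zero_of_mem_graded (by omega) (phiHat_mem_graded ν₀ k (m - n) hv), map_zero]
  have hT : cubic P (phiHat ν₀ k m v) = ∑ a ∈ Finset.Icc 1 P, ∑ b ∈ Finset.Icc 1 P,
      (phiHat ν₀ k m ((c (-(a : ℤ)) * (c (-(b : ℤ)) * c ((a : ℤ) + b)) +
          c (-((a : ℤ) + b)) * (c b * c a)) v) +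
        ((k : ℂ) * ν₀) • (c (-(a : ℤ)) (c (-(b : ℤ)) (phiHat ν₀ k (m - a - b) v)) +
          phiHat ν₀ k (m + a + b) (c b (c a v)) + (X a (a + b) + X (a + b) a) +
          (X (b + a) b + X b (b + a))) +
        ((k : ℂ) * ν₀) ^ 2 • c (-((a + b : ℕ) : ℤ)) (phiHat ν₀ k (m - (a + b : ℕ)) v) -
        ((k : ℂ) * ν₀) ^ 2 • phiHat ν₀ k (m + (a + b : ℕ)) (c (a + b : ℕ) v)) := by
    rw [cubic, LinearMap.sum_apply]
    refine Finset.sum_congr rfl fun a ha => ?_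
    rw [LinearMap.sum_apply]
    refine Finset.sum_congr rfl fun b hb => ?_
    have ha := (Finset.mem_Icc.1 ha).1
    have hb := (Finset.mem_Icc.1 hb).1
    simp only [LinearMap.add_apply, Module.End.mul_apply, map_add]
    rw [two_creation_commutator ν₀ k m v ha hb, two_annihilation_commutator ν₀ k m v ha hb,
      add_comm b a]
    simp only [hX]
    module
  have hXc : ∑ a ∈ Finset.Icc 1 P, ∑ b ∈ Finset.Icc 1 P, (X (b + a) b + X b (b + a)) =
      ∑ a ∈ Finset.Icc 1 P, ∑ b ∈ Finset.Icc 1 P, (X (a + b) a + X a (a + b)) := Finset.sum_comm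
  have hXt : ∑ i ∈ Finset.Icc 1 P, ∑ j ∈ Finset.Icc 1 P, X j i =
      ∑ i ∈ Finset.Icc 1 P, ∑ j ∈ Finset.Icc 1 P, X i j := Finset.sum_comm
  rw [hT]
  have hcub : phiHat ν₀ k m (cubic P v) = ∑ a ∈ Finset.Icc 1 P, ∑ b ∈ Finset.Icc 1 P,
      phiHat ν₀ k m ((c (-(a : ℤ)) * (c (-(b : ℤ)) * c ((a : ℤ) + b)) +
          c (-((a : ℤ) + b)) * (c b * c a)) v) := by
    simp only [cubic, LinearMap.sum_apply, map_sum]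
  rw [hcub]
  simp only [Finset.sum_add_distrib, Finset.sum_sub_distrib, ← Finset.smul_sum] at hXs hXs' hXc ⊢
  rw [hA, hC]
  linear_combination (norm := module) ((k : ℂ) * ν₀) • (hXs + hXs' + hXc + hXt - (2 : ℂ) • hdiag)

/-- The Fourier modes of the second derivative of a vertex operator. -/
theorem mode_sq_smul_phiHat (ν₀ : ℝ) (k m : ℤ) {q d : ℤ} {v : Db} (hv : v ∈ graded q d) {P : ℕ}
    (hP : d ≤ P) (hP' : d + m ≤ P) :
    ((m : ℂ) ^ 2) • phiHat ν₀ k m v =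
      ((k : ℂ) * ν₀) ^ 2 • (∑ i ∈ Finset.Icc 1 P, ∑ j ∈ Finset.Icc 1 P,
          c (-(i : ℤ)) (c (-(j : ℤ)) (phiHat ν₀ k (m - i - j) v)) +
        ∑ i ∈ Finset.Icc 1 P, ∑ j ∈ Finset.Icc 1 P, phiHat ν₀ k (m + i + j) (c j (c i v)) +
        (2 : ℂ) • ∑ i ∈ Finset.Icc 1 P, ∑ j ∈ Finset.Icc 1 P,
          c (-(j : ℤ)) (phiHat ν₀ k (m - j + i) (c i v))) +
      ((k : ℂ) * ν₀) • (∑ n ∈ Finset.Icc 1 P, (n : ℂ) • c (-(n : ℤ)) (phiHat ν₀ k (m - n) v) -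
        ∑ n ∈ Finset.Icc 1 P, (n : ℂ) • phiHat ν₀ k (m + n) (c n v)) := by
  -- Apply the first-derivative identity again, to the modes `m - n` and `m + n`. Replacing their
  -- own mode number by `m` costs `n` and `-n`, which gives the terms linear in `k ν₀`.
  have h : ∀ n : ℕ, (m : ℂ) • (c (-(n : ℤ)) (phiHat ν₀ k (m - n) v) +
        phiHat ν₀ k (m + n) (c n v)) =
      ((k : ℂ) * ν₀) • ∑ i ∈ Finset.Icc 1 P,
        (c (-(n : ℤ)) (c (-(i : ℤ)) (phiHat ν₀ k (m - n - i) v)) +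
          c (-(n : ℤ)) (phiHat ν₀ k (m - n + i) (c i v)) +
          c (-(i : ℤ)) (phiHat ν₀ k (m - i + n) (c n v)) +
          phiHat ν₀ k (m + n + i) (c i (c n v))) +
      ((n : ℂ) • c (-(n : ℤ)) (phiHat ν₀ k (m - n) v) -
        (n : ℂ) • phiHat ν₀ k (m + n) (c n v)) := by
    intro n
    have h1 := congrArg (c (-(n : ℤ)))
      (mode_smul_phiHat ν₀ k (m - n) hv hP (by omega))
    have h2 := mode_smul_phiHat ν₀ k (m + n) (c_mem_graded n hv) (P := P) (by omega) (by omega)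
    have e : ∀ i : ℕ, m + (n : ℤ) - i = m - i + n := fun i => by ring
    simp only [e] at h2
    simp only [map_smul, map_sum, map_add, Finset.sum_add_distrib] at h1 h2 ⊢
    push_cast at h1 h2
    linear_combination (norm := module) h1 + h2
  rw [pow_two, mul_smul, mode_smul_phiHat ν₀ k m hv hP hP', smul_comm, Finset.smul_sum,
    Finset.sum_congr rfl fun n _ => h n]
  have hXt : ∑ i ∈ Finset.Icc 1 P, ∑ j ∈ Finset.Icc 1 P,
      c (-(i : ℤ)) (phiHat ν₀ k (m - i + j) (c j v)) =
      ∑ i ∈ Finset.Icc 1 P, ∑ j ∈ Finset.Icc 1 P,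
      c (-(j : ℤ)) (phiHat ν₀ k (m - j + i) (c i v)) := Finset.sum_comm
  simp only [Finset.sum_add_distrib, Finset.sum_sub_distrib, ← Finset.smul_sum]
  linear_combination (norm := module) ((k : ℂ) * ν₀) ^ 2 • hXt

/-- With `μ = k ν₀`, the factor `κ = ν / μ` turns the quadratic terms of the cubic commutator into
`κ m²`. The dependence on `d` cancels against the charge shift in `2 ν 𝒬 ∑ c₋ₙ cₙ`, and `hν` removes
the creation terms. -/
theorem H3_commutator (ν₀ ν : ℝ) (k m : ℤ) (κ : ℂ) (hκ : (ν : ℂ) = κ * (k * ν₀))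
    (hν : (ν : ℂ) * (k * ν₀) ^ 2 - ν + (1 - ν ^ 2) * (k * ν₀) = 0)
    {q d : ℤ} {v : Db} (hv : v ∈ graded q d) {P : ℕ} (hP : d ≤ P) (hP' : d + m ≤ P) :
    H3 ν₀ ν (phiHat ν₀ k m v) = phiHat ν₀ k m (H3 ν₀ ν v) +
      (κ * m ^ 2 + 2 * ν * (ν₀ * q + k * ν₀ / 2) * m + ν * (k * ν₀) * (ν₀ * q + k * ν₀ / 2) ^ 2 +
        ν / 12 * ((k * ν₀) ^ 3 - ν ^ 2 * (k * ν₀)) : ℂ) • phiHat ν₀ k m v -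
      (2 * (ν : ℂ) * ((k * ν₀) ^ 2 - 1)) • ∑ n ∈ Finset.Icc 1 P,
        (n : ℂ) • phiHat ν₀ k (m + n) (c n v) := by
  have h1 := cubic_commutator ν₀ k m hv hP hP'
  have h2 := mode_sq_smul_phiHat ν₀ k m hv hP hP'
  have h3 := mode_smul_phiHat ν₀ k m hv hP hP'
  have h4 : ∑ n ∈ Finset.Icc 1 P, (n : ℂ) • c (-(n : ℤ)) (c n (phiHat ν₀ k m v)) =
      phiHat ν₀ k m (∑ n ∈ Finset.Icc 1 P, (n : ℂ) • c (-(n : ℤ)) (c n v)) +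
      ((k : ℂ) * ν₀) • (∑ n ∈ Finset.Icc 1 P, (n : ℂ) • c (-(n : ℤ)) (phiHat ν₀ k (m - n) v) +
        ∑ n ∈ Finset.Icc 1 P, (n : ℂ) • phiHat ν₀ k (m + n) (c n v)) := by
    rw [map_sum, ← Finset.sum_add_distrib, Finset.smul_sum, ← Finset.sum_add_distrib]
    refine Finset.sum_congr rfl fun n hn => ?_
    rw [phiHat_number_commutator ν₀ k m (Finset.mem_Icc.1 hn).1 v, map_smul]
    module
  rw [Finset.sum_add_distrib] at h3
  rw [H3_apply ν₀ ν hv hP, H3_apply ν₀ ν (phiHat_mem_graded ν₀ k m hv) hP', map_add, map_add,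
    map_smul, map_smul, map_smul, h1, h4]
  generalize (∑ n ∈ Finset.Icc 1 P, (n : ℂ) • c (-(n : ℤ)) (phiHat ν₀ k (m - n) v)) = c₁ at *
  generalize (∑ n ∈ Finset.Icc 1 P, (n : ℂ) • phiHat ν₀ k (m + n) (c n v)) = a₁ at *
  -- This is exactly the coefficient of `c₁`. Subtracting it from that of `a₁` leaves `-2 ν ((k ν₀)²
  -- - 1)`.
  have h5 : ((ν : ℂ) * (k * ν₀) ^ 2 - ν + (1 - ν ^ 2) * (k * ν₀)) • (c₁ + a₁) = 0 := by
    rw [hν, zero_smul]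
  push_cast
  rw [hκ] at h5 ⊢
  linear_combination (norm := module) h5 - κ • h2 + (κ * (k * ν₀) ^ 2) • h3

/-! ### Products of vertex operators -/

/-- A product of Fourier modes of vertex operators applied to `|Q⟩`. -/
noncomputable def chain (ν₀ : ℝ) (Q : ℤ) {K : ℕ} (k m : Fin K → ℤ) : Db :=
  (List.ofFn fun j => phiHat ν₀ (k j) (m j)).prod (charged Q)

theorem chain_zero (ν₀ : ℝ) (Q : ℤ) (k m : Fin 0 → ℤ) : chain ν₀ Q k m = charged Q := by
  simp [chain]

theorem chain_succ (ν₀ : ℝ) (Q : ℤ) {K : ℕ} (k m : Fin (K + 1) → ℤ) :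
    chain ν₀ Q k m = phiHat ν₀ (k 0) (m 0)
      (chain ν₀ Q (fun j => k j.succ) fun j => m j.succ) := by
  simp [chain, List.ofFn_succ]

theorem charged_mem (Q : ℤ) : charged Q ∈ graded Q 0 := by
  rw [charged, Rpow, ofBoson_boson]
  exact boson_mem ⟨by simp, by simp [deg]⟩

theorem chain_mem (ν₀ : ℝ) (Q : ℤ) {K : ℕ} (k m : Fin K → ℤ) :
    chain ν₀ Q k m ∈ graded (Q + ∑ j, k j) (∑ j, m j) := by
  induction K with
  | zero => simpa [chain_zero] using charged_mem Q
  | succ K ih =>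
    rw [chain_succ, Fin.sum_univ_succ, Fin.sum_univ_succ, add_comm (k 0), add_comm (m 0),
      ← add_assoc]
    exact phiHat_mem_graded _ _ _ (ih _ _)

theorem tailSum_succ {K : ℕ} (m : Fin (K + 1) → ℤ) (j : Fin K) :
    tailSum m j.succ = tailSum (fun i => m i.succ) j := by
  simp only [tailSum]
  rw [← Fin.map_succEmb_Ici, Finset.sum_map]
  rfl

theorem tailSum_zero {K : ℕ} (m : Fin (K + 1) → ℤ) : tailSum m 0 = ∑ j, m j := by
  rw [tailSum]
  congr 1
  ext j
  simp

/-- The factors from the `j`-th on already give a state of degree `tailSum m j`. -/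
theorem chain_eq_zero (ν₀ : ℝ) (Q : ℤ) {K : ℕ} (k m : Fin K → ℤ) (j : Fin K)
    (hj : tailSum m j < 0) : chain ν₀ Q k m = 0 := by
  induction K with
  | zero => exact j.elim0
  | succ K ih =>
    induction j using Fin.cases with
    | zero =>
      rw [tailSum_zero] at hj
      exact eq_zero_of_mem_graded hj (chain_mem ν₀ Q k m)
    | succ j =>
      rw [tailSum_succ] at hj
      rw [chain_succ, ih _ _ j hj, map_zero]

/-- Commute `c n` to the right until it kills `|Q⟩`; passing a factor lowers its mode number by `n`.
-/
theorem c_chain (ν₀ : ℝ) (Q : ℤ) {K : ℕ} (k m : Fin K → ℤ) {n : ℤ} (hn : 0 < n) :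
    c n (chain ν₀ Q k m) =
      ∑ j, ((k j : ℂ) * ν₀) • chain ν₀ Q k (m - n • Pi.single j 1) := by
  induction K with
  | zero =>
    rw [chain_zero, Finset.univ_eq_empty, Finset.sum_empty]
    exact eq_zero_of_mem_graded (by omega) (c_mem_graded n (charged_mem Q))
  | succ K ih =>
    rw [chain_succ, c_phiHat_apply ν₀ _ hn.ne', ih, Fin.sum_univ_succ, map_sum, add_comm]
    congr 1
    · rw [chain_succ]
      simp
    · refine Finset.sum_congr rfl fun j _ => ?_
      rw [map_smul, chain_succ]
      congr 3
      · simp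
      · congr 1
        ext i
        simp [Pi.single_apply]

theorem chain_raise_zero (ν₀ : ℝ) (Q : ℤ) {K : ℕ} (k m : Fin (K + 1) → ℤ) (n : ℤ) (l : Fin K) :
    chain ν₀ Q k (m + n • rootVec 0 l.succ) = phiHat ν₀ (k 0) (m 0 + n)
      (chain ν₀ Q (fun j => k j.succ) ((fun j => m j.succ) - n • Pi.single l 1)) := by
  rw [chain_succ]
  congr 2
  · simp [rootVec]
  · ext i
    simp [rootVec, Pi.single_apply]
    split_ifs <;> ring

theorem chain_raise_succ (ν₀ : ℝ) (Q : ℤ) {K : ℕ} (k m : Fin (K + 1) → ℤ) (n : ℤ)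
    (j l : Fin K) :
    chain ν₀ Q k (m + n • rootVec j.succ l.succ) = phiHat ν₀ (k 0) (m 0)
      (chain ν₀ Q (fun j => k j.succ) ((fun j => m j.succ) + n • rootVec j l)) := by
  rw [chain_succ]
  congr 2
  · simp [rootVec]
  · ext i
    simp [rootVec, Pi.single_apply]

/-- The diagonal part of the action of `H^{ν,3}` on a product of vertex operators. -/
noncomputable def chainEnergy (ν₀ ν : ℝ) (Q : ℤ) {K : ℕ} (κ : Fin K → ℂ) (k m : Fin K → ℤ) : ℂ :=
  ∑ j, (κ j * m j ^ 2
      + 2 * ν * (ν₀ * ((Q + ∑ l ∈ Finset.Ioi j, k l : ℤ) : ℂ) + k j * ν₀ / 2) * m j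
      + ν * (k j * ν₀) * (ν₀ * ((Q + ∑ l ∈ Finset.Ioi j, k l : ℤ) : ℂ) + k j * ν₀ / 2) ^ 2
      + ν / 12 * ((k j * ν₀) ^ 3 - ν ^ 2 * (k j * ν₀)))
    + ν / 3 * (ν₀ * Q) ^ 3 - ν ^ 3 / 12 * (ν₀ * Q)

/-- Induction on the leftmost factor. The sum over `n` is really finite; stating it for all large
cutoffs lets the commutators of the different factors share one `P`. -/
theorem H3_chain (ν₀ ν : ℝ) (Q : ℤ) {K : ℕ} (κ : Fin K → ℂ) (k m : Fin K → ℤ)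
    (hκ : ∀ j, (ν : ℂ) = κ j * (k j * ν₀))
    (hν : ∀ j, (ν : ℂ) * (k j * ν₀) ^ 2 - ν + (1 - ν ^ 2) * (k j * ν₀) = 0) :
    ∀ᶠ P : ℕ in Filter.atTop, H3 ν₀ ν (chain ν₀ Q k m) =
      chainEnergy ν₀ ν Q κ k m • chain ν₀ Q k m -
      (2 : ℂ) • ∑ j, ∑ l ∈ Finset.Ioi j, ((ν : ℂ) * (k l * ν₀) * ((k j * ν₀) ^ 2 - 1)) •
        ∑ n ∈ Finset.Icc 1 P, (n : ℂ) • chain ν₀ Q k (m + (n : ℤ) • rootVec j l) := by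
  induction K with
  | zero =>
    refine Filter.Eventually.of_forall fun P => ?_
    rw [chain_zero, H3_apply ν₀ ν (charged_mem Q) (P := 0) le_rfl]
    simp [chainEnergy, cubic]
  | succ K ih =>
    have hF := chain_mem ν₀ Q (fun j => k j.succ) fun j => m j.succ
    filter_upwards [ih (fun j => κ j.succ) (fun j => k j.succ) (fun j => m j.succ)
        (fun j => hκ j.succ) (fun j => hν j.succ),
      Filter.eventually_ge_atTop (∑ j : Fin K, m j.succ).toNat,
      Filter.eventually_ge_atTop (∑ j : Fin K, m j.succ + m 0).toNat] with P hP h1 h2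
    rw [chain_succ, H3_commutator ν₀ ν (k 0) (m 0) (κ 0) (hκ 0) (hν 0) hF (P := P) (by omega)
      (by omega), hP, Fin.sum_univ_succ, Fin.sum_Ioi_zero]
    simp only [Fin.sum_Ioi_succ, chain_raise_zero, chain_raise_succ]
    -- The first mode gains `n` and the mode hit by `c n` loses `n`: a raising by `n • rootVec 0
    -- l.succ`.
    have h3 : ∀ n ∈ Finset.Icc 1 P,
        (n : ℂ) • phiHat ν₀ (k 0) (m 0 + n)
          (c (n : ℤ) (chain ν₀ Q (fun j => k j.succ) fun j => m j.succ)) =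
        ∑ l : Fin K, ((k l.succ : ℂ) * ν₀) • (n : ℂ) • phiHat ν₀ (k 0) (m 0 + n)
          (chain ν₀ Q (fun j => k j.succ) ((fun j => m j.succ) - (n : ℤ) • Pi.single l 1)) := by
      intro n hn
      have hn := (Finset.mem_Icc.1 hn).1
      rw [c_chain ν₀ Q _ _ (by omega), map_sum, Finset.smul_sum]
      refine Finset.sum_congr rfl fun l _ => ?_
      rw [map_smul, smul_comm]
    rw [Finset.sum_congr rfl h3, Finset.sum_comm]
    have h4 : chainEnergy ν₀ ν Q κ k m =
        chainEnergy ν₀ ν Q (fun j => κ j.succ) (fun j => k j.succ) (fun j => m j.succ) +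
        (κ 0 * (m 0) ^ 2 + 2 * ν * (ν₀ * ((Q + ∑ j : Fin K, k j.succ : ℤ) : ℂ) + k 0 * ν₀ / 2) * m 0
          + ν * (k 0 * ν₀) * (ν₀ * ((Q + ∑ j : Fin K, k j.succ : ℤ) : ℂ) + k 0 * ν₀ / 2) ^ 2
          + ν / 12 * ((k 0 * ν₀) ^ 3 - ν ^ 2 * (k 0 * ν₀))) := by
      rw [chainEnergy, chainEnergy, Fin.sum_univ_succ]
      simp only [Fin.sum_Ioi_zero, Fin.sum_Ioi_succ]
      ring
    have h5 : ∀ l : Fin K, ((ν : ℂ) * (k l.succ * ν₀) * ((k 0 * ν₀) ^ 2 - 1)) •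
        ∑ n ∈ Finset.Icc 1 P, (n : ℂ) • phiHat ν₀ (k 0) (m 0 + n)
          (chain ν₀ Q (fun j => k j.succ) ((fun j => m j.succ) - (n : ℤ) • Pi.single l 1)) =
        ((ν : ℂ) * ((k 0 * ν₀) ^ 2 - 1)) • ∑ n ∈ Finset.Icc 1 P, ((k l.succ : ℂ) * ν₀) • (n : ℂ) •
          phiHat ν₀ (k 0) (m 0 + n)
          (chain ν₀ Q (fun j => k j.succ) ((fun j => m j.succ) - (n : ℤ) • Pi.single l 1)) := by
      intro l
      rw [← Finset.smul_sum, smul_smul]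
      congr 1
      ring
    rw [Finset.sum_congr rfl fun l _ => h5 l, ← Finset.smul_sum, h4]
    simp only [map_sub, map_smul, map_sum]
    module

/-! ### The triangular recursion -/

section Recursion

variable {K : ℕ}

theorem tailSum_add (m x : Fin K → ℤ) (j : Fin K) :
    tailSum (m + x) j = tailSum m j + tailSum x j := by
  simp [tailSum, Finset.sum_add_distrib]

theorem tailSum_smul (z : ℤ) (x : Fin K → ℤ) (j : Fin K) :
    tailSum (z • x) j = z * tailSum x j := by
  simp [tailSum, Finset.mul_sum]

theorem tailSum_rootVec (j k i : Fin K) :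
    tailSum (rootVec j k) i = (if i ≤ j then 1 else 0) - if i ≤ k then 1 else 0 := by
  simp [tailSum, rootVec, Finset.sum_sub_distrib, Pi.single_apply]

theorem tailSum_rootVec_right {j k : Fin K} (hjk : j < k) : tailSum (rootVec j k) k = -1 := by
  simp [tailSum_rootVec, hjk.not_ge]

theorem tailSum_rootVec_nonpos {j k : Fin K} (hjk : j < k) (i : Fin K) :
    tailSum (rootVec j k) i ≤ 0 := by
  rw [tailSum_rootVec]
  split_ifs with h1 h2
  · simp
  · exact absurd (h1.trans hjk.le) h2
  · simp
  · simp

theorem tailSum_injective : Function.Injective (tailSum (K := K)) := by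
  induction K with
  | zero => exact fun m n _ => Subsingleton.elim m n
  | succ K ih =>
    intro m n h
    have h1 : (fun i : Fin K => m i.succ) = fun i => n i.succ := by
      apply ih
      ext j
      rw [← tailSum_succ, ← tailSum_succ, h]
    have h2 : m 0 = n 0 := by
      have := congrFun h 0
      rw [tailSum_zero, tailSum_zero, Fin.sum_univ_succ, Fin.sum_univ_succ] at this
      have h3 : ∑ i : Fin K, m i.succ = ∑ i : Fin K, n i.succ :=
        Finset.sum_congr rfl fun i _ => congrFun h1 i
      linarith
    ext i
    induction i using Fin.cases with
    | zero => exact h2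
    | succ i => exact congrFun h1 i

theorem IsRaised.refl (n : Fin K → ℤ) : IsRaised n n := ⟨0, by simp⟩

theorem IsRaised.add_rootVec {n m : Fin K → ℤ} (h : IsRaised n m) {j k : Fin K} (hjk : j < k)
    (z : ℕ) : IsRaised n (m + (z : ℤ) • rootVec j k) := by
  obtain ⟨μ, rfl⟩ := h
  refine ⟨μ + Pi.single j (Pi.single k z), ?_⟩
  rw [add_assoc]
  congr 1
  have h1 : ∀ i l : Fin K, (((Pi.single j (Pi.single k z) : Fin K → Fin K → ℕ) i l : ℕ) : ℤ) •
      rootVec i l = if i = j then if l = k then (z : ℤ) • rootVec j k else 0 else 0 := by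
    intro i l
    by_cases hi : i = j
    · subst hi
      by_cases hl : l = k
      · subst hl; simp
      · simp [hl]
    · simp [hi]
  simp only [Pi.add_apply, Nat.cast_add, add_smul, Finset.sum_add_distrib, h1]
  congr 1
  rw [Finset.sum_eq_single j]
  · simp [hjk]
  · intro i _ hi
    simp [hi]
  · simp

/-- Raising increases every linear functional with decreasing coefficients. -/
theorem IsRaised.sum_mul_le {n m : Fin K → ℤ} (h : IsRaised n m) {p : Fin K → ℝ}
    (hp : ∀ j k, j < k → p k ≤ p j) : ∑ i, p i * n i ≤ ∑ i, p i * m i := by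
  obtain ⟨μ, rfl⟩ := h
  have h1 : ∑ i, p i * ((n + ∑ j, ∑ k ∈ Finset.Ioi j, (μ j k : ℤ) • rootVec j k) i : ℤ) =
      ∑ i, p i * n i + ∑ j, ∑ k ∈ Finset.Ioi j, (μ j k : ℝ) * (p j - p k) := by
    have h2 : ∀ j k, (μ j k : ℝ) * (p j - p k) =
        ∑ i, p i * (((μ j k : ℤ) • rootVec j k) i : ℤ) := by
      intro j k
      simp [rootVec, Pi.single_apply, mul_sub, Finset.sum_sub_distrib, mul_comm]
      ring
    simp only [h2, Pi.add_apply, Finset.sum_apply, Int.cast_add, Int.cast_sum, mul_add,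
      Finset.sum_add_distrib, Finset.mul_sum]
    congr 1
    rw [Finset.sum_comm]
    refine Finset.sum_congr rfl fun j _ => ?_
    rw [Finset.sum_comm]
  rw [h1, le_add_iff_nonneg_right]
  refine Finset.sum_nonneg fun j _ => Finset.sum_nonneg fun k hk => ?_
  exact mul_nonneg (Nat.cast_nonneg _) (sub_nonneg.2 (hp j k (Finset.mem_Ioi.1 hk)))

/-- Minus a tail sum is a functional with decreasing coefficients. -/
theorem IsRaised.ple {n m : Fin K → ℤ} (h : IsRaised n m) : PLe m n := by
  intro j
  have h1 := h.sum_mul_le (p := fun i => if j ≤ i then -1 else 0) (by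
    intro i k hik
    split_ifs with h1 h2 h2
    · exact le_rfl
    · norm_num
    · exact absurd (h2.trans hik.le) h1
    · exact le_rfl)
  have h2 : ∀ m : Fin K → ℤ, ∑ i, (if j ≤ i then (-1 : ℝ) else 0) * m i = -(tailSum m j : ℝ) := by
    intro m
    rw [tailSum, ← Finset.sum_filter_add_sum_filter_not Finset.univ (fun i => j ≤ i)]
    have : Finset.univ.filter (fun i => j ≤ i) = Finset.Ici j := by ext; simp
    rw [Finset.sum_congr rfl (fun i hi => by rw [if_pos (Finset.mem_filter.1 hi).2]),
      Finset.sum_eq_zero (s := Finset.univ.filter fun i => ¬ j ≤ i)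
        (fun i hi => by rw [if_neg (Finset.mem_filter.1 hi).2, zero_mul]), this]
    simp
  rw [h2, h2] at h1
  exact_mod_cast neg_le_neg_iff.1 h1

theorem IsRaised.sum_eq {n m : Fin K → ℤ} (h : IsRaised n m) : ∑ i, m i = ∑ i, n i := by
  have h1 := h.sum_mul_le (p := fun _ => 1) (fun _ _ _ => le_rfl)
  have h2 := h.sum_mul_le (p := fun _ => -1) (fun _ _ _ => le_rfl)
  simp only [one_mul, neg_one_mul, Finset.sum_neg_distrib] at h1 h2
  have h3 : ((∑ i, m i : ℤ) : ℝ) = ((∑ i, n i : ℤ) : ℝ) := by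
    push_cast
    linarith
  exact_mod_cast h3

theorem occurs_self {n : Fin K → ℤ} (hn : ∀ j, 0 ≤ n j) : Occurs n n :=
  ⟨IsRaised.refl n, fun _ => Finset.sum_nonneg fun k _ => hn k⟩

/-- A vector is determined by its tail sums, which here lie between `0` and those of `n`. -/
theorem finite_occurs (n : Fin K → ℤ) : {m | Occurs n m}.Finite := by
  refine ((Set.finite_Icc (0 : Fin K → ℤ) (tailSum n)).preimage
    (tailSum_injective.injOn)).subset ?_
  rintro m ⟨h1, h2⟩
  exact ⟨h2, h1.ple⟩

/-- The number of elementary steps from `n` to `m`. -/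
def height (n m : Fin K → ℤ) : ℕ := (∑ i, (tailSum n i - tailSum m i)).toNat

theorem height_lt {n m : Fin K → ℤ} {j k : Fin K} (hjk : j < k) (μ : ℕ+)
    (h : Occurs n (m - (μ : ℤ) • rootVec j k)) :
    height n (m - (μ : ℤ) • rootVec j k) < height n m := by
  have hμ : (0 : ℤ) < μ := by exact_mod_cast μ.pos
  have e : ∀ i, tailSum (m - (μ : ℤ) • rootVec j k) i =
      tailSum m i - μ * tailSum (rootVec j k) i := by
    intro i
    rw [sub_eq_add_neg, ← neg_smul, tailSum_add, tailSum_smul]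
    ring
  -- Without this sign the `toNat` in `height` could turn the strict inequality into an equality.
  have h1 : 0 ≤ ∑ i, (tailSum n i - tailSum (m - (μ : ℤ) • rootVec j k) i) :=
    Finset.sum_nonneg fun i _ => sub_nonneg.2 (h.1.ple i)
  have h2 : ∑ i, (tailSum n i - tailSum (m - (μ : ℤ) • rootVec j k) i) <
      ∑ i, (tailSum n i - tailSum m i) := by
    refine Finset.sum_lt_sum (fun i _ => ?_) ⟨k, Finset.mem_univ k, ?_⟩
    · rw [e]
      have := mul_nonneg hμ.le (neg_nonneg.2 (tailSum_rootVec_nonpos hjk i))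
      linarith
    · rw [e, tailSum_rootVec_right hjk]
      linarith
  rw [height, height]
  omega

end Recursion

/-! ### Existence, uniqueness and finite support of the coefficients -/

section Solution

variable (ν₀ ν : ℝ) {N M : ℕ} (Q : ℤ) {n : Fin (N + M) → ℤ}

open Classical in
/-- The solution of the triangular recursion. -/
noncomputable def solution (n m : Fin (N + M) → ℤ) : ℂ :=
  if m = n then 1 else if Occurs n m then
    ((2 / bdiff ν₀ ν N M Q n m : ℝ) : ℂ) * ∑ j, ∑ k ∈ Finset.Ioi j, (gam ν N M j k : ℂ) *
      ∑ᶠ μ : ℕ+, (μ : ℂ) * if height n (m - (μ : ℤ) • rootVec j k) < height n m then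
        solution n (m - (μ : ℤ) • rootVec j k) else 0
  else 0
termination_by height n m
decreasing_by assumption

theorem not_occurs_of_plt {m : Fin (N + M) → ℤ} (h : PLt n m) : ¬ Occurs n m := fun ho =>
  h.2 (tailSum_injective (funext fun j => le_antisymm (h.1 j) (ho.1.ple j)))

/-- The height guard in `solution` only serves well-foundedness: by `height_lt`, an argument that
fails it does not occur, so its value is zero anyway. -/
theorem isRecursive_solution (hn : ∀ j, 0 ≤ n j) :
    IsRecursive ν₀ ν N M Q n (solution ν₀ ν Q n) := by
  have h0 : ∀ m, ¬ Occurs n m → m ≠ n → solution ν₀ ν Q n m = 0 := by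
    intro m hm hmn
    rw [solution, if_neg hmn, if_neg hm]
  refine ⟨fun m hm => h0 m (not_occurs_of_plt hm) (Ne.symm hm.2), ?_, fun m hm hmn => ?_, h0⟩
  · rw [solution, if_pos rfl]
  · rw [solution, if_neg hmn, if_pos hm]
    congr 1
    refine Finset.sum_congr rfl fun j _ => Finset.sum_congr rfl fun k hk => ?_
    congr 1
    refine finsum_congr fun μ => ?_
    congr 1
    split_ifs with h
    · rfl
    · refine (h0 _ (fun ho => h (height_lt (Finset.mem_Ioi.1 hk) μ ho)) fun he => ?_).symm
      refine h (height_lt (Finset.mem_Ioi.1 hk) μ ?_)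
      rw [he]
      exact occurs_self hn

variable {ν₀ ν Q}

theorem IsRecursive.occurs_of_ne_zero {u : (Fin (N + M) → ℤ) → ℂ}
    (hu : IsRecursive ν₀ ν N M Q n u) (hn : ∀ j, 0 ≤ n j) {m : Fin (N + M) → ℤ} (hm : u m ≠ 0) :
    Occurs n m := by
  by_contra h
  refine hm (hu.2.2.2 m h fun he => h ?_)
  rw [he]
  exact occurs_self hn

theorem IsRecursive.unique {u w : (Fin (N + M) → ℤ) → ℂ} (hu : IsRecursive ν₀ ν N M Q n u)
    (hw : IsRecursive ν₀ ν N M Q n w) (hn : ∀ j, 0 ≤ n j) : u = w := by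
  have key : ∀ H : ℕ, ∀ m, height n m = H → u m = w m := by
    intro H
    induction H using Nat.strong_induction_on with
    | _ H ih =>
      intro m hH
      by_cases hmn : m = n
      · rw [hmn, hu.2.1, hw.2.1]
      by_cases hm : Occurs n m
      · rw [hu.2.2.1 m hm hmn, hw.2.2.1 m hm hmn]
        congr 1
        refine Finset.sum_congr rfl fun j _ => Finset.sum_congr rfl fun k hk => ?_
        congr 1
        refine finsum_congr fun μ => ?_
        congr 1
        by_cases ho : Occurs n (m - (μ : ℤ) • rootVec j k)
        · exact ih _ (hH ▸ height_lt (Finset.mem_Ioi.1 hk) μ ho) _ rfl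
        · rw [not_not.1 (mt (hu.occurs_of_ne_zero hn) ho),
            not_not.1 (mt (hw.occurs_of_ne_zero hn) ho)]
      · rw [hu.2.2.2 m hm hmn, hw.2.2.2 m hm hmn]
  exact funext fun m => key _ m rfl

theorem IsRecursive.finite_support {u : (Fin (N + M) → ℤ) → ℂ}
    (hu : IsRecursive ν₀ ν N M Q n u) (hn : ∀ j, 0 ≤ n j) : (Function.support u).Finite :=
  (finite_occurs n).subset fun _ hm => hu.occurs_of_ne_zero hn hm

/-- Subtracting `μ (e_j - e_k)` adds `μ` to the tail sum at `k`, which on the support of `u` stays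
below that of `n`. -/
theorem IsRecursive.eventually_finsum_eq {u : (Fin (N + M) → ℤ) → ℂ}
    (hu : IsRecursive ν₀ ν N M Q n u) (hn : ∀ j, 0 ≤ n j) (m : Fin (N + M) → ℤ)
    {j k : Fin (N + M)} (hjk : j < k) :
    ∀ᶠ P : ℕ in Filter.atTop, ∑ᶠ μ : ℕ+, (μ : ℂ) * u (m - (μ : ℤ) • rootVec j k) =
      ∑ i ∈ Finset.Icc 1 P, (i : ℂ) * u (m - (i : ℤ) • rootVec j k) := by
  filter_upwards [Filter.eventually_ge_atTop (tailSum n k - tailSum m k).toNat] with P hP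
  rw [← sum_box P fun i => (i : ℂ) * u (m - (i : ℤ) • rootVec j k)]
  refine finsum_eq_sum_of_support_subset _ fun μ hμ => ?_
  have h1 := (hu.occurs_of_ne_zero hn (right_ne_zero_of_mul hμ)).1.ple k
  rw [sub_eq_add_neg, ← neg_smul, tailSum_add, tailSum_smul, tailSum_rootVec_right hjk] at h1
  rw [Finset.mem_coe, mem_box]
  omega

end Solution

/-! ### Non-degeneracy -/

/-- Raising increases the sum of the squares of decreasing pseudo-momenta. -/
theorem IsRaised.sum_sq_lt {K : ℕ} {n m : Fin K → ℤ} (h : IsRaised n m) (hmn : m ≠ n)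
    {p q : Fin K → ℝ} (hp : ∀ j k, j < k → p k ≤ p j) (hq : ∀ j, q j = p j + (m j - n j)) :
    ∑ j, p j ^ 2 < ∑ j, q j ^ 2 := by
  have h1 := h.sum_mul_le hp
  -- Expand the square around `p`: the cross term is non-negative because `p` is decreasing, and the
  -- last sum is positive because `m ≠ n`.
  have h2 : ∑ j, q j ^ 2 = ∑ j, p j ^ 2 + 2 * (∑ j, p j * m j - ∑ j, p j * n j) +
      ∑ j, ((m j : ℝ) - n j) ^ 2 := by
    rw [← Finset.sum_sub_distrib, Finset.mul_sum, ← Finset.sum_add_distrib,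
      ← Finset.sum_add_distrib]
    refine Finset.sum_congr rfl fun j _ => ?_
    rw [hq]
    ring
  have h3 : 0 < ∑ j, ((m j : ℝ) - n j) ^ 2 := by
    obtain ⟨j, hj⟩ := Function.ne_iff.1 hmn
    refine Finset.sum_pos' (fun _ _ => sq_nonneg _) ⟨j, Finset.mem_univ j, ?_⟩
    have : (m j : ℝ) - n j ≠ 0 := sub_ne_zero.2 (by exact_mod_cast hj)
    positivity
  linarith

theorem nplus_eq_add (ν₀ ν : ℝ) (N M : ℕ) (Q : ℤ) (n m : Fin (N + M) → ℤ) (j : Fin (N + M)) :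
    nplus ν₀ ν N M Q m j = nplus ν₀ ν N M Q n j + (m j - n j) := by
  rw [nplus, nplus]
  split_ifs <;> ring

theorem nonDegenerate_of_right_eq_zero {ν₀ ν : ℝ} {r s N : ℕ} {Q : ℤ} {n : Fin (N + 0) → ℤ}
    (hn : Restricted r s N 0 Q n) : NonDegenerate ν₀ ν N 0 Q n := by
  intro m hm hmn
  have hlt : ∀ j : Fin (N + 0), (j : ℕ) < N := fun j => j.2
  have h := hm.1.sum_sq_lt hmn (p := nplus ν₀ ν N 0 Q n) (q := nplus ν₀ ν N 0 Q m) (by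
    intro j k hjk
    have h1 := hn.2.2.1 j k hjk.le (hlt k)
    have h2 : (n k : ℝ) ≤ n j := by exact_mod_cast h1
    have h3 : ((j : ℕ) : ℝ) ≤ (k : ℕ) := by exact_mod_cast hjk.le
    rw [nplus, nplus, if_pos (hlt j), if_pos (hlt k)]
    have := mul_le_mul_of_nonneg_left h3 (sq_nonneg ν)
    linarith) (nplus_eq_add ν₀ ν N 0 Q n m)
  rw [bdiff, E3, E3]
  simp only [hlt, if_true, one_mul]
  linarith

theorem nonDegenerate_of_left_eq_zero {ν₀ ν : ℝ} (hν : 0 < ν) {r s M : ℕ} {Q : ℤ}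
    {n : Fin (0 + M) → ℤ} (hn : Restricted r s 0 M Q n) : NonDegenerate ν₀ ν 0 M Q n := by
  intro m hm hmn
  have h := hm.1.sum_sq_lt hmn (p := nplus ν₀ ν 0 M Q n) (q := nplus ν₀ ν 0 M Q m) (by
    intro j k hjk
    have h1 := hn.2.2.2.2.1 j k hjk.le (Nat.zero_le _)
    have h2 : (n k : ℝ) ≤ n j := by exact_mod_cast h1
    have h3 : ((j : ℕ) : ℝ) ≤ (k : ℕ) := by exact_mod_cast hjk.le
    rw [nplus, nplus, if_neg (Nat.not_lt_zero _), if_neg (Nat.not_lt_zero _)]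
    have := mul_le_mul_of_nonneg_left h3 (inv_nonneg.2 (sq_nonneg ν))
    linarith) (nplus_eq_add ν₀ ν 0 M Q n m)
  rw [bdiff, E3, E3]
  simp only [Nat.not_lt_zero, if_false, ← Finset.mul_sum]
  have := mul_lt_mul_of_pos_left h (pow_pos hν 2)
  linarith

theorem nonDegenerate_one_one {ν₀ ν : ℝ} (hν : 0 < ν) {r s : ℕ} {Q : ℤ} {n : Fin (1 + 1) → ℤ}
    (hn : Restricted r s 1 1 Q n) : NonDegenerate ν₀ ν 1 1 Q n := by
  rintro m ⟨⟨μ, rfl⟩, hm⟩ hmn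
  have hroot : n + ∑ j, ∑ k ∈ Finset.Ioi j, (μ j k : ℤ) • rootVec j k =
      n + (μ 0 1 : ℤ) • rootVec 0 1 := by
    congr 1
    rw [Fin.sum_univ_two]
    have h1 : Finset.Ioi (0 : Fin (1 + 1)) = {1} := by decide
    have h2 : Finset.Ioi (1 : Fin (1 + 1)) = ∅ := by decide
    rw [h1, h2]
    simp
  rw [hroot] at hm hmn ⊢
  generalize μ 0 1 = z at hm hmn ⊢
  have hz : 1 ≤ z := by
    by_contra h
    have : z = 0 := by omega
    exact hmn (by simp [this])
  have h0 := hn.2.2.2.1 0 (by decide)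
  have h1 := hm 1
  rw [tailSum_add, tailSum_smul, tailSum_rootVec_right (by decide)] at h1
  have h2 : tailSum n 1 = n 1 := by
    have h2 : Finset.Ici (1 : Fin (1 + 1)) = {1} := by decide
    rw [tailSum, h2, Finset.sum_singleton]
  rw [h2] at h1
  have hz' : (1 : ℝ) ≤ z := by exact_mod_cast hz
  have h0' : (1 : ℝ) ≤ n 0 := by
    have : (1 : ℤ) ≤ n 0 := by
      split_ifs at h0 <;> push_cast at h0 <;> omega
    exact_mod_cast this
  have h1' : (z : ℝ) ≤ n 1 := by
    have : (z : ℤ) ≤ n 1 := by linarith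
    exact_mod_cast this
  -- The only freedom is the multiple `z` of the single root. The dependence on `Q` cancels between
  -- the two pseudo-momenta, and `1 ≤ z ≤ n 1` with `1 ≤ n 0` makes this positive.
  have hb : bdiff ν₀ ν 1 1 Q n (n + (z : ℤ) • rootVec 0 1) =
      z * (2 * n 0 - 1 + ν ^ 2 + z + ν ^ 2 * (2 * n 1 - z)) := by
    have hν' : ν ≠ 0 := hν.ne'
    rw [bdiff, E3, E3]
    simp [Fin.sum_univ_two, nplus, rootVec]
    field_simp
    ring
  rw [hb]
  have h3 : 0 ≤ ν ^ 2 * (2 * n 1 - z) := mul_nonneg (sq_nonneg ν) (by linarith)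
  have h4 := sq_nonneg ν
  exact (mul_pos (by linarith) (by linarith)).ne'

/-! ### The anyon states -/

/-- The charges of the vertex operators in an anyon state. -/
def anyonCharge (r s N M : ℕ) (j : Fin (N + M)) : ℤ := if (j : ℕ) < N then (r : ℤ) else -(s : ℤ)

theorem sum_anyonCharge (r s N M : ℕ) :
    ∑ j, anyonCharge r s N M j = (N : ℤ) * r - M * s := by
  simp [Fin.sum_univ_add, anyonCharge]
  ring

theorem sum_Ioi_anyonCharge (r s N M : ℕ) (j : Fin (N + M)) :
    ∑ l ∈ Finset.Ioi j, anyonCharge r s N M l =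
      if (j : ℕ) < N then ((N : ℤ) - 1 - (j : ℕ)) * r - M * s
      else -(((N : ℤ) + M - 1 - (j : ℕ)) * s) := by
  have h1 : ∑ l ∈ Finset.Ioi j, anyonCharge r s N M l =
      ∑ i ∈ Finset.Ioo (j : ℕ) (N + M), if i < N then (r : ℤ) else -(s : ℤ) := by
    rw [← Fin.map_valEmbedding_Ioi, Finset.sum_map]
    rfl
  have hj := j.2
  rw [h1, Finset.sum_ite, Finset.sum_const, Finset.sum_const, nsmul_eq_mul, nsmul_eq_mul]
  split_ifs with h
  · have e1 : (Finset.Ioo (j : ℕ) (N + M)).filter (fun i => i < N) = Finset.Ioo (j : ℕ) N := by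
      ext i; simp only [Finset.mem_filter, Finset.mem_Ioo]; omega
    have e2 : (Finset.Ioo (j : ℕ) (N + M)).filter (fun i => ¬ i < N) = Finset.Ico N (N + M) := by
      ext i; simp only [Finset.mem_filter, Finset.mem_Ioo, Finset.mem_Ico]; omega
    rw [e1, e2, Nat.card_Ioo, Nat.card_Ico]
    have e3 : ((N - (j : ℕ) - 1 : ℕ) : ℤ) = N - 1 - (j : ℕ) := by omega
    have e4 : ((N + M - N : ℕ) : ℤ) = M := by omega
    rw [e3, e4]
    ring
  · have e1 : (Finset.Ioo (j : ℕ) (N + M)).filter (fun i => i < N) = ∅ := by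
      refine Finset.filter_eq_empty_iff.2 fun i hi => ?_
      rw [Finset.mem_Ioo] at hi
      omega
    have e2 : (Finset.Ioo (j : ℕ) (N + M)).filter (fun i => ¬ i < N) =
        Finset.Ioo (j : ℕ) (N + M) := by
      ext i; simp only [Finset.mem_filter, Finset.mem_Ioo]; omega
    rw [e1, e2, Nat.card_Ioo]
    have e3 : ((N + M - (j : ℕ) - 1 : ℕ) : ℤ) = N + M - 1 - (j : ℕ) := by omega
    rw [e3]
    simp

/-- Telescoping: with `S` the charge to the right, `k (S + k / 2)` is half the increment of the
squared charge. -/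
theorem sum_charge_mul (Q : ℤ) {K : ℕ} (k : Fin K → ℤ) :
    ∑ j, (k j : ℝ) * (((Q + ∑ l ∈ Finset.Ioi j, k l : ℤ) : ℝ) + k j / 2) =
      1 / 2 * (((Q + ∑ j, k j : ℤ) : ℝ) ^ 2 - (Q : ℝ) ^ 2) := by
  induction K with
  | zero => simp
  | succ K ih =>
    rw [Fin.sum_univ_succ, Fin.sum_Ioi_zero, Fin.sum_univ_succ]
    simp only [Fin.sum_Ioi_succ]
    rw [ih]
    push_cast
    ring

/-! ### Identifying the eigenvalues -/

section Parameters

variable {r s : ℕ} {ν₀ ν : ℝ}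

theorem anyonCharge_mul (hν : ν = r * ν₀) (hν' : ν⁻¹ = s * ν₀) (N M : ℕ) 
    (j : Fin (N + M)) :
    (anyonCharge r s N M j : ℝ) * ν₀ = if (j : ℕ) < N then ν else -ν⁻¹ := by
  rw [anyonCharge]
  split_ifs
  · rw [hν]; push_cast; ring
  · rw [hν']; push_cast; ring

/-- The shift in the pseudo-momentum is the parameter `ν_j` times the charge (in units `ν₀`) of all
factors to the right together with half the factor's own. -/
theorem nplus_eq (hν : ν = r * ν₀) (hν' : ν⁻¹ = s * ν₀) (N M : ℕ) (Q : ℤ)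
    (hν₀ : ν ≠ 0) (m : Fin (N + M) → ℤ) (j : Fin (N + M)) :
    nplus ν₀ ν N M Q m j = m j + anyonCharge r s N M j * ν₀ *
      (ν₀ * ((Q + ∑ l ∈ Finset.Ioi j, anyonCharge r s N M l : ℤ) : ℝ) +
        anyonCharge r s N M j * ν₀ / 2) := by
  have h1 : ν₀ * ((Q + ∑ l ∈ Finset.Ioi j, anyonCharge r s N M l : ℤ) : ℝ) =
      ν₀ * Q + if (j : ℕ) < N then (N - 1 - (j : ℕ)) * ν - M * ν⁻¹
        else -((N + M - 1 - (j : ℕ)) * ν⁻¹) := by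
    rw [sum_Ioi_anyonCharge]
    split_ifs
    · rw [hν', hν]; push_cast; ring
    · rw [hν']; push_cast; ring
  rw [h1, anyonCharge_mul hν hν', nplus]
  split_ifs
  · field_simp
    ring
  · field_simp
    ring

theorem E1_eq (hν : ν = r * ν₀) (hν' : ν⁻¹ = s * ν₀) (N M : ℕ) (Q : ℤ)
    (hν₀ : ν ≠ 0) :
    ν⁻¹ * (ν₀ * ((Q + ∑ j, anyonCharge r s N M j : ℤ) : ℝ)) = E1 ν₀ ν N M Q := by
  have h1 : ν₀ * ((Q + ∑ j, anyonCharge r s N M j : ℤ) : ℝ) = ν₀ * Q + N * ν - M * ν⁻¹ := by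
    rw [sum_anyonCharge, hν', hν]
    push_cast
    ring
  rw [h1, E1]
  field_simp
  ring

theorem E2_eq (hν : ν = r * ν₀) (hν' : ν⁻¹ = s * ν₀) (N M : ℕ) (Q : ℤ)
    (hν₀ : ν ≠ 0) (m : Fin (N + M) → ℤ) :
    1 / 2 * (ν₀ * ((Q + ∑ j, anyonCharge r s N M j : ℤ) : ℝ)) ^ 2 + ((∑ j, m j : ℤ) : ℝ) =
      E2 ν₀ ν N M Q m := by
  rw [E2, Finset.sum_congr rfl fun j _ => nplus_eq hν hν' N M Q hν₀ m j, Finset.sum_add_distrib]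
  have h := sum_charge_mul Q (anyonCharge r s N M)
  have h1 : ∑ j, (anyonCharge r s N M j : ℝ) * ν₀ *
      (ν₀ * ((Q + ∑ l ∈ Finset.Ioi j, anyonCharge r s N M l : ℤ) : ℝ) +
        anyonCharge r s N M j * ν₀ / 2) =
      ν₀ ^ 2 * ∑ j, (anyonCharge r s N M j : ℝ) *
        (((Q + ∑ l ∈ Finset.Ioi j, anyonCharge r s N M l : ℤ) : ℝ) +
          anyonCharge r s N M j / 2) := by
    rw [Finset.mul_sum]
    exact Finset.sum_congr rfl fun j _ => by ring
  rw [h1, h]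
  push_cast
  ring

/-- Completing the square, with `κ μ = ν`, turns each summand into `κ (m + μ x)²`, where `m + μ x`
is the pseudo-momentum. The remainder `ν (μ³ - ν² μ) / 12` is zero for `μ = ν` and `(ν² - ν⁻²) / 12`
for `μ = -1/ν`. -/
theorem chainEnergy_eq (hν : ν = r * ν₀) (hν' : ν⁻¹ = s * ν₀) (N M : ℕ) (Q : ℤ)
    (hν₀ : ν ≠ 0) (m : Fin (N + M) → ℤ) :
    chainEnergy ν₀ ν Q (fun j : Fin (N + M) => if (j : ℕ) < N then 1 else -(ν : ℂ) ^ 2)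
      (anyonCharge r s N M) m = (E3 ν₀ ν N M Q m : ℝ) := by
  have h1 : ∑ j : Fin (N + M), (if (j : ℕ) < N then (0 : ℝ) else 1 / 12 * (ν ^ 2 - (ν ^ 2)⁻¹)) =
      1 / 12 * (ν ^ 2 - (ν ^ 2)⁻¹) * M := by
    simp [Fin.sum_univ_add]
    ring
  rw [E3, ← h1, ← Finset.sum_add_distrib, chainEnergy]
  push_cast
  have h2 : (ν : ℂ) / 3 * (ν₀ * Q) ^ 3 = ν * (ν₀ * Q) ^ 3 / 3 := by ring
  have h3 : (ν : ℂ) ^ 3 / 12 * (ν₀ * Q) = ν ^ 3 * (ν₀ * Q) / 12 := by ring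
  rw [h2, h3]
  congr 2
  refine Finset.sum_congr rfl fun j _ => ?_
  have h4 := anyonCharge_mul hν hν' N M j
  have h5 : ((anyonCharge r s N M j : ℂ)) * ν₀ = if (j : ℕ) < N then (ν : ℂ) else -(ν : ℂ)⁻¹ := by
    rw [← Complex.ofReal_intCast, ← Complex.ofReal_mul, h4]
    split_ifs <;> simp
  have hν₁ : (ν : ℂ) ≠ 0 := by exact_mod_cast hν₀
  rw [nplus_eq hν hν' N M Q hν₀]
  push_cast
  rw [h5]
  split_ifs
  · push_cast
    ring
  · push_cast
    field_simp
    ring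

theorem H3_eta (hν : ν = r * ν₀) (hν' : ν⁻¹ = s * ν₀) (N M : ℕ) (Q : ℤ)
    (hν₀ : ν ≠ 0) (m : Fin (N + M) → ℤ) :
    ∀ᶠ P : ℕ in Filter.atTop, H3 ν₀ ν (eta ν₀ r s N M Q m) =
      ((E3 ν₀ ν N M Q m : ℝ) : ℂ) • eta ν₀ r s N M Q m -
      (2 : ℂ) • ∑ j, ∑ l ∈ Finset.Ioi j, (gam ν N M j l : ℂ) •
        ∑ i ∈ Finset.Icc 1 P, (i : ℂ) • eta ν₀ r s N M Q (m + (i : ℤ) • rootVec j l) := by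
  have hν₁ : (ν : ℂ) ≠ 0 := by exact_mod_cast hν₀
  have h5 : ∀ j, ((anyonCharge r s N M j : ℂ)) * ν₀ =
      if (j : ℕ) < N then (ν : ℂ) else -(ν : ℂ)⁻¹ := by
    intro j
    rw [← Complex.ofReal_intCast, ← Complex.ofReal_mul, anyonCharge_mul hν hν' N M j]
    split_ifs <;> simp
  have h := H3_chain ν₀ ν Q (fun j : Fin (N + M) => if (j : ℕ) < N then 1 else -(ν : ℂ) ^ 2)
    (anyonCharge r s N M) m (by
      intro j
      rw [h5]
      split_ifs
      · ring
      · field_simp) (by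
      intro j
      rw [h5]
      split_ifs
      · ring
      · field_simp
        ring)
  rw [chainEnergy_eq hν hν' N M Q hν₀] at h
  have h6 : ∀ j l : Fin (N + M), (ν : ℂ) * (anyonCharge r s N M l * ν₀) *
      ((anyonCharge r s N M j * ν₀) ^ 2 - 1) = (gam ν N M j l : ℂ) := by
    intro j l
    by_cases hj : (j : ℕ) < N <;> by_cases hl : (l : ℕ) < N <;> simp [h5, gam, hj, hl]
  simp only [h6] at h
  exact h

end Parameters

/-! ### The eigenstates -/

theorem eta_mem (ν₀ : ℝ) (r s N M : ℕ) (Q : ℤ) (m : Fin (N + M) → ℤ) :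
    eta ν₀ r s N M Q m ∈ graded (Q + ∑ j, anyonCharge r s N M j) (∑ j, m j) :=
  chain_mem ν₀ Q (anyonCharge r s N M) m

theorem eta_eq_zero (ν₀ : ℝ) (r s N M : ℕ) (Q : ℤ) (m : Fin (N + M) → ℤ) (j : Fin (N + M))
    (hj : tailSum m j < 0) : eta ν₀ r s N M Q m = 0 :=
  chain_eq_zero ν₀ Q (anyonCharge r s N M) m j hj

section Eigenstates

variable {r s : ℕ} {ν₀ ν : ℝ} {N M : ℕ} {Q : ℤ} {n : Fin (N + M) → ℤ}
  {u : (Fin (N + M) → ℤ) → ℂ}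

theorem psiTilde_eq_sum (hu : IsRecursive ν₀ ν N M Q n u) (hn : ∀ j, 0 ≤ n j) :
    psiTilde ν₀ r s N M Q n u =
      ∑ m ∈ (finite_occurs n).toFinset, u m • eta ν₀ r s N M Q m := by
  have hmem : n ∈ (finite_occurs n).toFinset := by simpa using occurs_self hn
  rw [psiTilde, ← Finset.add_sum_erase _ _ hmem, hu.2.1, one_smul]
  congr 1
  refine finsum_mem_eq_sum_of_inter_support_eq (s := {m | PLt m n}) _ ?_
  ext m
  simp only [Set.mem_inter_iff, Set.mem_ofPred_eq, Function.mem_support, Finset.mem_coe,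
    Finset.mem_erase, Set.Finite.mem_toFinset]
  constructor
  · rintro ⟨h1, h2⟩
    exact ⟨⟨h1.2, hu.occurs_of_ne_zero hn (left_ne_zero_of_smul h2)⟩, h2⟩
  · rintro ⟨⟨h1, h2⟩, h3⟩
    exact ⟨⟨h2.1.ple, h1⟩, h3⟩

theorem psiTilde_mem (hu : IsRecursive ν₀ ν N M Q n u) (hn : ∀ j, 0 ≤ n j) :
    psiTilde ν₀ r s N M Q n u ∈ graded (Q + ∑ j, anyonCharge r s N M j) (∑ j, n j) := by
  rw [psiTilde_eq_sum hu hn]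
  refine Submodule.sum_mem _ fun m hm => Submodule.smul_mem _ _ ?_
  have hm : Occurs n m := by simpa using hm
  rw [← hm.1.sum_eq]
  exact eta_mem ν₀ r s N M Q m

theorem sum_smul_eta_raise (hu : IsRecursive ν₀ ν N M Q n u) (hn : ∀ j, 0 ≤ n j)
    {j k : Fin (N + M)} (hjk : j < k) (i : ℕ) :
    ∑ m ∈ (finite_occurs n).toFinset, u m • eta ν₀ r s N M Q (m + (i : ℤ) • rootVec j k) =
      ∑ m ∈ (finite_occurs n).toFinset,
        u (m - (i : ℤ) • rootVec j k) • eta ν₀ r s N M Q m := by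
  rw [← finsum_eq_sum_of_support_subset (s := (finite_occurs n).toFinset)
      (fun m => u m • eta ν₀ r s N M Q (m + (i : ℤ) • rootVec j k)),
    ← finsum_eq_sum_of_support_subset (s := (finite_occurs n).toFinset)
      (fun m => u (m - (i : ℤ) • rootVec j k) • eta ν₀ r s N M Q m),
    ← finsum_comp_equiv (Equiv.addRight ((i : ℤ) • rootVec j k))
      (f := fun m => u (m - (i : ℤ) • rootVec j k) • eta ν₀ r s N M Q m)]
  · simp
  -- The shifted index is again raised from `n`; if it leaves the finite set through a negative tail
  -- sum, its state is zero.
  · intro m hm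
    have h1 := (hu.occurs_of_ne_zero hn (left_ne_zero_of_smul hm)).1.add_rootVec hjk i
    rw [sub_add_cancel] at h1
    simp only [Set.Finite.coe_toFinset, Set.mem_ofPred_eq]
    refine ⟨h1, fun l => ?_⟩
    by_contra h
    exact right_ne_zero_of_smul hm (eta_eq_zero ν₀ r s N M Q m l (not_le.1 h))
  · intro m hm
    simpa using hu.occurs_of_ne_zero hn (left_ne_zero_of_smul hm)

/-- Away from `n` this is the recursion multiplied by the non-zero energy difference. At `n` both
sides vanish, since undoing a raising would push a tail sum above that of `n`. -/
theorem recursion_eigenvalue (hnd : NonDegenerate ν₀ ν N M Q n)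
    (hu : IsRecursive ν₀ ν N M Q n u) (hn : ∀ j, 0 ≤ n j) {m : Fin (N + M) → ℤ}
    (hm : Occurs n m) :
    2 * ∑ j, ∑ k ∈ Finset.Ioi j, (gam ν N M j k : ℂ) *
        ∑ᶠ μ : ℕ+, (μ : ℂ) * u (m - (μ : ℤ) • rootVec j k) =
      ((E3 ν₀ ν N M Q m : ℝ) - (E3 ν₀ ν N M Q n : ℝ) : ℂ) * u m := by
  by_cases hmn : m = n
  · subst hmn
    rw [sub_self, zero_mul, Finset.sum_eq_zero, mul_zero]
    intro j _
    refine Finset.sum_eq_zero fun k hk => ?_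
    rw [finsum_eq_zero_of_forall_eq_zero, mul_zero]
    intro μ
    rw [not_not.1 (mt (hu.occurs_of_ne_zero hn) fun ho => ?_), mul_zero]
    have h1 := ho.1.ple k
    rw [sub_eq_add_neg, ← neg_smul, tailSum_add, tailSum_smul,
      tailSum_rootVec_right (Finset.mem_Ioi.1 hk)] at h1
    have := μ.pos
    omega
  · have hb : ((bdiff ν₀ ν N M Q n m : ℝ) : ℂ) ≠ 0 := by exact_mod_cast hnd m hm hmn
    rw [hu.2.2.1 m hm hmn, ← Complex.ofReal_sub, ← bdiff]
    push_cast
    field_simp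

theorem H3_psiTilde (hν : ν = r * ν₀) (hν' : ν⁻¹ = s * ν₀) (hν₀ : ν ≠ 0)
    (hnd : NonDegenerate ν₀ ν N M Q n) (hu : IsRecursive ν₀ ν N M Q n u) (hn : ∀ j, 0 ≤ n j) :
    H3 ν₀ ν (psiTilde ν₀ r s N M Q n u) =
      ((E3 ν₀ ν N M Q n : ℝ) : ℂ) • psiTilde ν₀ r s N M Q n u := by
  rw [psiTilde_eq_sum hu hn]
  set A := (finite_occurs n).toFinset with hA
  have h1 : ∀ᶠ P : ℕ in Filter.atTop, ∀ m ∈ A, H3 ν₀ ν (eta ν₀ r s N M Q m) =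
      ((E3 ν₀ ν N M Q m : ℝ) : ℂ) • eta ν₀ r s N M Q m -
      (2 : ℂ) • ∑ j, ∑ l ∈ Finset.Ioi j, (gam ν N M j l : ℂ) •
        ∑ i ∈ Finset.Icc 1 P, (i : ℂ) • eta ν₀ r s N M Q (m + (i : ℤ) • rootVec j l) :=
    (Filter.eventually_all_finset A).2 fun m _ => H3_eta hν hν' N M Q hν₀ m
  have h2 : ∀ᶠ P : ℕ in Filter.atTop, ∀ m ∈ A, ∀ j ∈ Finset.univ, ∀ l ∈ Finset.Ioi j,
      ∑ᶠ μ : ℕ+, (μ : ℂ) * u (m - (μ : ℤ) • rootVec j l) =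
        ∑ i ∈ Finset.Icc 1 P, (i : ℂ) * u (m - (i : ℤ) • rootVec j l) :=
    (Filter.eventually_all_finset A).2 fun m _ =>
      (Filter.eventually_all_finset _).2 fun j _ => (Filter.eventually_all_finset _).2 fun l hl =>
        hu.eventually_finsum_eq hn m (Finset.mem_Ioi.1 hl)
  -- A single cutoff for the action on all states of the finite set and for all the sums in the
  -- recursion.
  obtain ⟨P, h1, h2⟩ := (h1.and h2).exists
  have h3 : ∑ m ∈ A, u m • ∑ j, ∑ l ∈ Finset.Ioi j, (gam ν N M j l : ℂ) •
        ∑ i ∈ Finset.Icc 1 P, (i : ℂ) • eta ν₀ r s N M Q (m + (i : ℤ) • rootVec j l) =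
      ∑ m ∈ A, (∑ j, ∑ l ∈ Finset.Ioi j, (gam ν N M j l : ℂ) *
        ∑ i ∈ Finset.Icc 1 P, (i : ℂ) * u (m - (i : ℤ) • rootVec j l)) •
          eta ν₀ r s N M Q m := by
    simp only [Finset.smul_sum, Finset.sum_smul, Finset.mul_sum]
    rw [Finset.sum_comm, Finset.sum_comm (s := A)]
    refine Finset.sum_congr rfl fun j _ => ?_
    rw [Finset.sum_comm, Finset.sum_comm (s := A)]
    refine Finset.sum_congr rfl fun l hl => ?_
    rw [Finset.sum_comm, Finset.sum_comm (s := A)]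
    refine Finset.sum_congr rfl fun i _ => ?_
    have h := congrArg (fun w => ((gam ν N M j l : ℂ) * i) • w)
      (sum_smul_eta_raise (r := r) (s := s) hu hn (Finset.mem_Ioi.1 hl) i)
    simp only [Finset.smul_sum, smul_smul] at h
    simp only [smul_smul]
    convert h using 3 <;> ring
  rw [map_sum, Finset.smul_sum]
  calc ∑ m ∈ A, H3 ν₀ ν (u m • eta ν₀ r s N M Q m)
      = ∑ m ∈ A, ((E3 ν₀ ν N M Q m : ℝ) * u m : ℂ) • eta ν₀ r s N M Q m -
        (2 : ℂ) • ∑ m ∈ A, u m • ∑ j, ∑ l ∈ Finset.Ioi j, (gam ν N M j l : ℂ) •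
        ∑ i ∈ Finset.Icc 1 P, (i : ℂ) • eta ν₀ r s N M Q (m + (i : ℤ) • rootVec j l) := by
        rw [Finset.smul_sum, ← Finset.sum_sub_distrib]
        refine Finset.sum_congr rfl fun m hm => ?_
        rw [map_smul, h1 m hm]
        module
    _ = ∑ m ∈ A, ((E3 ν₀ ν N M Q n : ℝ) : ℂ) • u m • eta ν₀ r s N M Q m := by
        rw [h3, Finset.smul_sum, ← Finset.sum_sub_distrib]
        refine Finset.sum_congr rfl fun m hm => ?_
        have hm' : Occurs n m := by simpa [hA] using hm
        have h4 := recursion_eigenvalue hnd hu hn hm'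
        rw [Finset.sum_congr rfl fun j hj => Finset.sum_congr rfl fun l hl => by
          rw [h2 m hm j hj l hl]] at h4
        rw [smul_smul, smul_smul, h4, ← sub_smul]
        congr 1
        ring

end Eigenstates

end AnyonCFT

theorem propositionB4 (r s : ℕ) (hr : 0 < r) (hs : 0 < s)
    (ν₀ ν : ℝ) (hν₀ : 0 < ν₀) (hν : ν = r * ν₀) (hν' : ν⁻¹ = s * ν₀)
    (N M : ℕ) (Q : ℤ) (n : Fin (N + M) → ℤ) (hn : ∀ j, 0 ≤ n j) :
    ((M = 0 ∨ N = 0 ∨ (N = 1 ∧ M = 1)) → AnyonCFT.Restricted r s N M Q n →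
      AnyonCFT.NonDegenerate ν₀ ν N M Q n) ∧
    (AnyonCFT.NonDegenerate ν₀ ν N M Q n →
      {m | AnyonCFT.Occurs n m}.Finite ∧
      (∃! u : (Fin (N + M) → ℤ) → ℂ, AnyonCFT.IsRecursive ν₀ ν N M Q n u) ∧
      ∀ u : (Fin (N + M) → ℤ) → ℂ, AnyonCFT.IsRecursive ν₀ ν N M Q n u →
        (Function.support u).Finite ∧
        (AnyonCFT.psiTilde ν₀ r s N M Q n u ≠ 0 →
          Module.End.HasEigenvector (AnyonCFT.H1 ν₀ ν)
            (AnyonCFT.E1 ν₀ ν N M Q : ℂ) (AnyonCFT.psiTilde ν₀ r s N M Q n u) ∧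
          Module.End.HasEigenvector (AnyonCFT.H2 ν₀)
            (AnyonCFT.E2 ν₀ ν N M Q n : ℂ) (AnyonCFT.psiTilde ν₀ r s N M Q n u) ∧
          Module.End.HasEigenvector (AnyonCFT.H3 ν₀ ν)
            (AnyonCFT.E3 ν₀ ν N M Q n : ℂ) (AnyonCFT.psiTilde ν₀ r s N M Q n u))) := by
  have hpos : 0 < ν := by
    rw [hν]
    exact mul_pos (by exact_mod_cast hr) hν₀
  refine ⟨?_, fun hnd => ⟨AnyonCFT.finite_occurs n, ?_, fun u hu => ?_⟩⟩
  · rintro (rfl | rfl | ⟨rfl, rfl⟩) hR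
    · exact AnyonCFT.nonDegenerate_of_right_eq_zero hR
    · exact AnyonCFT.nonDegenerate_of_left_eq_zero hpos hR
    · exact AnyonCFT.nonDegenerate_one_one hpos hR
  · exact ⟨AnyonCFT.solution ν₀ ν Q n, AnyonCFT.isRecursive_solution ν₀ ν Q hn,
      fun w hw => hw.unique (AnyonCFT.isRecursive_solution ν₀ ν Q hn) hn⟩
  · refine ⟨hu.finite_support hn, fun hne => ?_⟩
    have hmem := AnyonCFT.psiTilde_mem (r := r) (s := s) hu hn
    refine ⟨⟨Module.End.mem_eigenspace_iff.2 ?_, hne⟩,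
      ⟨Module.End.mem_eigenspace_iff.2 ?_, hne⟩, ⟨Module.End.mem_eigenspace_iff.2 ?_, hne⟩⟩
    · rw [AnyonCFT.H1_apply ν₀ ν hmem, ← AnyonCFT.E1_eq hν hν' N M Q hpos.ne']
      push_cast
      rfl
    · rw [AnyonCFT.H2_apply ν₀ hmem, ← AnyonCFT.E2_eq hν hν' N M Q hpos.ne']
      push_cast
      rfl
    · exact AnyonCFT.H3_psiTilde hν hν' hpos.ne' hnd hu hn
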